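/- Let $W=\{W(t),t\in\mathbb{R}\}$ be a zero-mean, stochastically continuous Gaussian process with stationary increments, $W(0)=0$ and variance $\sigma^2(t)=\operatorname{Var}W(t)$. Let $W_i$, $i\in\mathbb{N}$, be independent copies of $W$ and, independently of them, let $\{U_i,i\in\mathbb{N}\}$ be a Poisson point process on $\mathbb{R}$ with intensity $e^{-x}\,dx$. Let $X$ be the Brown--Resnick process $$X(t)=\max_{i\in\mathbb{N}} e^{U_i+W_i(t)-\sigma^2(t)/2},\qquad t\in\mathbb{R},$$ where for each $t$ the maximum exists almost surely. For a measurable set $D\subset\mathbb{R}_+=[0,\infty)$, its (upper) asymptotic density is $\limsup_{T\to+\infty}T^{-1}\lambda(D\cap[0,T])$, where $\lambda$ is Lebesgue measure. Call $X$ ergodic if it is stationary and every measurable set of paths (in the product $\sigma$-algebra of $\mathbb{R}^{\mathbb{R}}$) that is invariant, up to null sets of the law of $X$, under all translations of time has probability $0$ or $1$. Then the following conditions are equivalent: 1. $X$ is ergodic. 2. There is a measurable set $D\subset\mathbb{R}_+$ of asymptotic density $0$ such that $\lim_{t\to+\infty,\,t\notin D}\sigma^2(t)=\infty$. 3. For every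 $\varepsilon>0$ there is a measurable set $D_\varepsilon\subset\mathbb{R}_+$ of asymptotic density at most $\varepsilon$ such that $\lim_{t\to+\infty,\,t\notin D_\varepsilon}\sigma^2(t)=\infty$. -/

import Mathlib

open MeasureTheory ProbabilityTheory Filter Topology
open scoped ENNReal NNReal

namespace BrownResnick

noncomputable section

/-- The number (in `ℕ∞`, counted with multiplicity) of points of the family `U` lying in `B`. -/
def pointCount {Ω E : Type*} (U : ℕ → Ω → E) (B : Set E) (ω : Ω) : ℕ∞ :=
  Set.encard {i : ℕ | U i ω ∈ B}

/-- The random points `U i`, `i ∈ ℕ`, form a Poisson point process with intensity measure `Λ`: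
the number of points in a measurable set of finite intensity is Poisson distributed with parameter
the intensity of that set, and the numbers of points in disjoint sets are independent. -/
structure IsPoissonPointProcess {Ω E : Type*} [MeasurableSpace Ω] [MeasurableSpace E]
    (U : ℕ → Ω → E) (Λ : Measure E) (P : Measure Ω) : Prop where
  measurable : ∀ i, Measurable (U i)
  hasLaw_count : ∀ B : Set E, MeasurableSet B → Λ B ≠ ∞ →
    HasLaw (pointCount U B)
      ((poissonMeasure (Λ B).toNNReal).map (fun n : ℕ => (n : ℕ∞))) P
  indep_count : ∀ (n : ℕ) (B : Fin n → Set E), (∀ j, MeasurableSet (B j)) →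
    Pairwise (fun j k => Disjoint (B j) (B k)) →
    iIndepFun (fun j => pointCount U (B j)) P

/-- The measure on `ℝ` with density `x ↦ e^{-x}` with respect to Lebesgue measure. -/
def expIntensity : Measure ℝ :=
  volume.withDensity fun x => ENNReal.ofReal (Real.exp (-x))

/-- `W` is a zero-mean, stochastically continuous Gaussian process on `ℝ` with stationary
increments and `W(0) = 0` almost surely. -/
structure IsGaussianStatIncr {Ω : Type*} [MeasurableSpace Ω]
    (W : ℝ → Ω → ℝ) (P : Measure Ω) : Prop where
  measurable : ∀ t, Measurable (W t)
  gaussian : IsGaussianProcess W P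
  mean_zero : ∀ t, ∫ ω, W t ω ∂P = 0
  stoch_cont : ∀ t, TendstoInMeasure P W (𝓝 t) (W t)
  stat_incr : ∀ s : ℝ,
    IdentDistrib (fun ω (t : ℝ) => W (t + s) ω - W s ω) (fun ω (t : ℝ) => W t ω - W 0 ω) P P
  zero_at_zero : W 0 =ᵐ[P] 0

/-- The `i`-th term `e^{U_i + W_i(t) - σ²(t)/2}` of the maximum defining the process. -/
def brTerm {Ω : Type*} (σ2 : ℝ → ℝ) (U : ℕ → Ω → ℝ) (W : ℕ → ℝ → Ω → ℝ)
    (t : ℝ) (ω : Ω) (i : ℕ) : ℝ :=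
  Real.exp (U i ω + W i t ω - σ2 t / 2)

/-- The process `X(t) = max_i e^{U_i + W_i(t) - σ²(t)/2}`. (That the supremum is almost surely
finite and attained is asserted in the theorem.) -/
def brProcess {Ω : Type*} (σ2 : ℝ → ℝ) (U : ℕ → Ω → ℝ) (W : ℕ → ℝ → Ω → ℝ)
    (t : ℝ) (ω : Ω) : ℝ :=
  ⨆ i : ℕ, brTerm σ2 U W t ω i

/-- The random inputs: the `W i` are independent copies of `W₀`, and the `U i` form a Poisson point
process on `ℝ` with intensity `e^{-x} dx`, independent of the `W i`. -/
structure IsBrownResnickInput {Ω Ω₀ : Type*} [MeasurableSpace Ω] [MeasurableSpace Ω₀]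
    (U : ℕ → Ω → ℝ) (W : ℕ → ℝ → Ω → ℝ) (P : Measure Ω)
    (W₀ : ℝ → Ω₀ → ℝ) (P₀ : Measure Ω₀) : Prop where
  measurable_W : ∀ i t, Measurable (W i t)
  copies : ∀ i, IdentDistrib (fun ω t => W i t ω) (fun ω t => W₀ t ω) P P₀
  indep_W : iIndepFun (fun i ω t => W i t ω) P
  poisson : IsPoissonPointProcess U expIntensity P
  indep_U_W : IndepFun (fun ω i => U i ω) (fun ω i t => W i t ω) P

/-- Translation by `s` on the path space `ℝ → ℝ`. -/
def shift (s : ℝ) (x : ℝ → ℝ) : ℝ → ℝ := fun t => x (t + s)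

/-- The law of a process on the path space `ℝ → ℝ` with the product `σ`-algebra. -/
def pathLaw {Ω : Type*} [MeasurableSpace Ω] (X : ℝ → Ω → ℝ) (P : Measure Ω) : Measure (ℝ → ℝ) :=
  P.map fun ω t => X t ω

/-- A process is ergodic if it is stationary and every event of its path space that is invariant
under all translations up to null sets has probability `0` or `1`. (For uncountably many times only
invariance up to null sets is meaningful: the only strictly invariant sets of the product
`σ`-algebra are the empty set and the whole space.) -/
structure IsErgodicProcess {Ω : Type*} [MeasurableSpace Ω] (X : ℝ → Ω → ℝ) (P : Measure Ω) :
    Prop where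
  measurable : ∀ t, Measurable (X t)
  stationary : ∀ s, MeasurePreserving (shift s) (pathLaw X P) (pathLaw X P)
  trivial_of_invariant : ∀ A : Set (ℝ → ℝ), MeasurableSet A →
    (∀ s, shift s ⁻¹' A =ᵐ[pathLaw X P] A) → pathLaw X P A = 0 ∨ pathLaw X P A = 1

/-- The upper asymptotic density `limsup_{T → ∞} λ(D ∩ [0, T]) / T` of a set `D`. -/
def upperDensity (D : Set ℝ) : ℝ≥0∞ :=
  limsup (fun T : ℝ => volume (D ∩ Set.Icc 0 T) / ENNReal.ofReal T) atTop

/-- `lim f(t) = ∞` as `t → +∞`, `t ∉ D`. -/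
def TendsToInftyOutside (f : ℝ → ℝ) (D : Set ℝ) : Prop :=
  Tendsto f (atTop ⊓ 𝓟 Dᶜ) atTop

end

end BrownResnick

namespace BrownResnick

noncomputable section

/-! All three conditions are equivalent to a fourth: `σ2` is unbounded.

The Poisson structure gives P(X(t_i) ≤ y_i for all i) = exp(-E max_i e^{W(t_i)-σ²(t_i)/2}/y_i)
(`measure_forall_le`). By Cameron–Martin the expectation is unchanged when all times are translated
(`lintegral_shift_eq`), so X is stationary. Since max = sum - min, the dependence between X near 0
and X near s is governed by E min(e^{W(0)-σ²(0)/2}, e^{W(s)-σ²(s)/2}). This is at most e^{-σ²(s)/8},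
and it is bounded below when σ² is bounded.

If σ² is unbounded, choose times along which it tends to infinity. Lower orthants then become
independent of their translates along these times, which forces every invariant event to be
independent of itself. If σ² is bounded, the event X(0) ≤ 1 has uniformly positive correlation with
its translates, and a minimal-norm argument in L² (`exists_measure_inter_preimage_lt`) contradicts
ergodicity.

The link with density is deterministic: σ² is continuous, even and satisfies σ²(s+t) ≤ 2σ²(s) +
2σ²(t). For unbounded σ² a sublevel set therefore has arbitrarily many disjoint translates, hence
density zero (`eventually_volume_sublevel_le`), and a diagonal argument assembles one exceptional
set. Conversely, divergence outside a set of small density excludes boundedness. -/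

/-- The map `x ↦ e^{-x}` on `[0, ∞]`, with values in `[0, 1]`. -/
def expNeg (x : ℝ≥0∞) : ℝ≥0∞ := EReal.exp (-(x : EReal))

lemma continuous_expNeg : Continuous expNeg :=
  ENNReal.continuous_exp.comp (continuous_neg.comp continuous_coe_ennreal_ereal)

lemma measurable_expNeg : Measurable expNeg := continuous_expNeg.measurable

lemma antitone_expNeg : Antitone expNeg := fun _ _ h =>
  EReal.exp_monotone (EReal.neg_le_neg_iff.2 (EReal.coe_ennreal_le_coe_ennreal_iff.2 h))

@[simp] lemma expNeg_zero : expNeg 0 = 1 := by simp [expNeg]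

@[simp] lemma expNeg_top : expNeg ∞ = 0 := by simp [expNeg]

lemma expNeg_le_one (x : ℝ≥0∞) : expNeg x ≤ 1 := by
  simpa using antitone_expNeg (bot_le : 0 ≤ x)

lemma expNeg_add (x y : ℝ≥0∞) : expNeg (x + y) = expNeg x * expNeg y := by
  rw [expNeg, expNeg, expNeg, ← EReal.exp_add, EReal.coe_ennreal_add,
    EReal.neg_add (Or.inl (EReal.coe_ennreal_ne_bot x)) (Or.inr (EReal.coe_ennreal_ne_bot y)),
    sub_eq_add_neg]

lemma expNeg_sum {ι : Type*} (s : Finset ι) (f : ι → ℝ≥0∞) :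
    expNeg (∑ i ∈ s, f i) = ∏ i ∈ s, expNeg (f i) := by
  classical
  induction s using Finset.induction_on with
  | empty => simp
  | insert a s ha ih => rw [Finset.sum_insert ha, Finset.prod_insert ha, expNeg_add, ih]

lemma expNeg_ofReal {x : ℝ} (hx : 0 ≤ x) :
    expNeg (ENNReal.ofReal x) = ENNReal.ofReal (Real.exp (-x)) := by
  rw [expNeg, EReal.coe_ennreal_ofReal, max_eq_left hx, ← EReal.coe_neg, EReal.exp_coe]

lemma expNeg_coe (x : ℝ≥0) : expNeg x = ENNReal.ofReal (Real.exp (-x)) := by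
  rw [← expNeg_ofReal x.coe_nonneg, ENNReal.ofReal_coe_nnreal]

/-- Writes a probability as an exponential, so that products of conditional probabilities become
Laplace functionals; probability 0 corresponds to exponent ∞. -/
lemma exists_expNeg_eq {x : ℝ≥0∞} (hx : x ≤ 1) : expNeg (-(ENNReal.log x)).toENNReal = x := by
  have h : 0 ≤ -(ENNReal.log x) := by
    rw [EReal.le_neg, neg_zero]; exact ENNReal.log_le_zero_iff.2 hx
  rw [expNeg, EReal.coe_toENNReal h, neg_neg, ENNReal.exp_log]

/-- The counting measure of the points `U i ω`. -/
def pointMeasure {Ω E : Type*} [MeasurableSpace E] (U : ℕ → Ω → E) (ω : Ω) : Measure E :=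
  Measure.sum fun i => Measure.dirac (U i ω)

/-! ### Laplace functional and mean measure of a Poisson process -/

section PointProcess

variable {Ω E : Type*} [MeasurableSpace E] {U : ℕ → Ω → E} {Λ : Measure E}

lemma lintegral_pointMeasure {f : E → ℝ≥0∞} (hf : Measurable f) (ω : Ω) :
    ∫⁻ x, f x ∂(pointMeasure U ω) = ∑' i, f (U i ω) := by
  simp [pointMeasure, lintegral_sum_measure, lintegral_dirac' _ hf]

lemma pointMeasure_apply {B : Set E} (hB : MeasurableSet B) (ω : Ω) :
    pointMeasure U ω B = pointCount U B ω := by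
  rw [pointCount, ← Measure.count_apply (Set.to_countable _).measurableSet, pointMeasure,
    Measure.sum_apply _ hB, Measure.count, Measure.sum_apply _ (Set.to_countable _).measurableSet]
  refine tsum_congr fun i => ?_
  rw [Measure.dirac_apply' _ hB, Measure.dirac_apply' _ (Set.to_countable _).measurableSet]
  rfl

variable [MeasurableSpace Ω] {P : Measure Ω}

lemma measurable_pointCount (hU : ∀ i, Measurable (U i)) {B : Set E} (hB : MeasurableSet B) :
    Measurable fun ω => (pointCount U B ω : ℝ≥0∞) := by
  simp_rw [← pointMeasure_apply hB, ← lintegral_indicator_one hB]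
  simp_rw [lintegral_pointMeasure (U := U) (measurable_one.indicator hB)]
  exact Measurable.tsum fun i => (measurable_one.indicator hB).comp (hU i)

lemma lintegral_pow_poissonMeasure (r : ℝ≥0) {q : ℝ} (hq : 0 ≤ q) :
    ∫⁻ n, ENNReal.ofReal (q ^ n) ∂(poissonMeasure r) = ENNReal.ofReal (Real.exp ((q - 1) * r)) := by
  rw [poissonMeasure, lintegral_sum_measure]
  have h : HasSum (fun n : ℕ => Real.exp (-r) * r ^ n / n.factorial * q ^ n)
      (Real.exp ((q - 1) * r)) := by
    have := (NormedSpace.expSeries_div_hasSum_exp ((q * r : ℝ))).mul_left (Real.exp (-r))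
    rw [← Real.exp_eq_exp_ℝ, ← Real.exp_add] at this
    convert! this using 1
    · ext n; rw [mul_pow]; ring
    · congr 1; ring
  rw [← h.tsum_eq, ENNReal.ofReal_tsum_of_nonneg (fun n => by positivity) h.summable]
  refine tsum_congr fun n => ?_
  rw [lintegral_smul_measure, lintegral_dirac, smul_eq_mul, ← ENNReal.ofReal_mul (by positivity)]

lemma IsPoissonPointProcess.lintegral_comp_count (hU : IsPoissonPointProcess U Λ P) {B : Set E}
    (hB : MeasurableSet B) (hΛ : Λ B ≠ ∞) (g : ℕ∞ → ℝ≥0∞) :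
    ∫⁻ ω, g (pointCount U B ω) ∂P = ∫⁻ n : ℕ, g n ∂(poissonMeasure (Λ B).toNNReal) := by
  rw [(hU.hasLaw_count B hB hΛ).lintegral_comp (f := g) (measurable_of_countable _).aemeasurable,
    lintegral_map (measurable_of_countable _) (measurable_of_countable _)]

/-- The generating function of the Poisson law at e^{-c}. Finite intensity is required only for c ≠
0, because a simple function may vanish on a set of infinite intensity; there 0 · ∞ = 0 makes both
sides 1. -/
lemma IsPoissonPointProcess.lintegral_expNeg_count (hU : IsPoissonPointProcess U Λ P)
    [IsProbabilityMeasure P] {B : Set E} (hB : MeasurableSet B) {c : ℝ≥0∞} (hc : c ≠ ∞)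
    (hΛ : c ≠ 0 → Λ B ≠ ∞) :
    ∫⁻ ω, expNeg (c * pointCount U B ω) ∂P = expNeg ((1 - expNeg c) * Λ B) := by
  rcases eq_or_ne c 0 with rfl | h0
  · simp
  replace hΛ := hΛ h0
  rw [hU.lintegral_comp_count hB hΛ (fun n => expNeg (c * n))]
  lift c to ℝ≥0 using hc
  have h1 : ∀ n : ℕ, expNeg (c * ((n : ℕ∞) : ℝ≥0∞)) = ENNReal.ofReal ((Real.exp (-c)) ^ n) := by
    intro n
    rw [← Real.exp_nat_mul, show ((n : ℝ) * -c) = -(c * n : ℝ) by ring,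
      ← expNeg_ofReal (by positivity), ENNReal.ofReal_mul c.coe_nonneg]
    simp
  simp_rw [h1]
  rw [lintegral_pow_poissonMeasure _ (Real.exp_pos _).le, expNeg_coe, ← ENNReal.ofReal_one,
    ← ENNReal.ofReal_sub _ (Real.exp_pos _).le]
  have h2 : 0 ≤ 1 - Real.exp (-(c : ℝ)) := by
    have := Real.exp_le_one_iff.2 (neg_nonpos.2 c.coe_nonneg)
    linarith
  rw [← ENNReal.ofReal_toReal hΛ, ← ENNReal.ofReal_mul h2, expNeg_ofReal (by positivity),
    ENNReal.ofReal_toReal hΛ]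
  congr 2
  rw [ENNReal.coe_toNNReal_eq_toReal]
  ring

/-- The sum over the points groups by the fibres of `f`, whose counts are independent, so the
expectation factors. The fibres are indexed by `Fin m` to match `indep_count`. -/
lemma IsPoissonPointProcess.lintegral_expNeg_simpleFunc (hU : IsPoissonPointProcess U Λ P)
    [IsProbabilityMeasure P] (f : SimpleFunc E ℝ≥0∞) (hf : ∀ x, f x ≠ ∞)
    (hΛ : ∀ c, c ≠ 0 → Λ (f ⁻¹' {c}) ≠ ∞) :
    ∫⁻ ω, expNeg (∑' i, f (U i ω)) ∂P = expNeg (∫⁻ x, (1 - expNeg (f x)) ∂Λ) := by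
  let m := f.range.card
  let e : f.range ≃ Fin m := f.range.equivFin
  have hsum : ∀ g : ℝ≥0∞ → ℝ≥0∞, ∑ c ∈ f.range, g c = ∑ j : Fin m, g (e.symm j) := by
    intro g
    rw [← Finset.sum_coe_sort, ← e.symm.sum_comp]
  have hL : ∀ ω, expNeg (∑' i, f (U i ω)) =
      ∏ j : Fin m, expNeg ((e.symm j : ℝ≥0∞) * pointCount U (f ⁻¹' {(e.symm j : ℝ≥0∞)}) ω) := by
    intro ω
    rw [← lintegral_pointMeasure f.measurable, SimpleFunc.lintegral_eq_lintegral,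
      SimpleFunc.lintegral, hsum (fun c => c * pointMeasure U ω (f ⁻¹' {c})), expNeg_sum]
    simp_rw [pointMeasure_apply (f.measurableSet_fiber _)]
  have hR : ∫⁻ x, (1 - expNeg (f x)) ∂Λ =
      ∑ j : Fin m, (1 - expNeg (e.symm j : ℝ≥0∞)) * Λ (f ⁻¹' {(e.symm j : ℝ≥0∞)}) := by
    rw [← hsum (fun c => (1 - expNeg c) * Λ (f ⁻¹' {c})), ← SimpleFunc.map_lintegral
      (fun c => 1 - expNeg c), ← SimpleFunc.lintegral_eq_lintegral]
    rfl
  simp_rw [hL]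
  rw [hR, expNeg_sum]
  have hind := hU.indep_count m (fun j => f ⁻¹' {(e.symm j : ℝ≥0∞)})
    (fun j => f.measurableSet_fiber _) (fun j k hjk => by
      refine Disjoint.preimage _ (Set.disjoint_singleton.2 fun h => hjk ?_)
      exact e.symm.injective (Subtype.ext h))
  have hind' := hind.comp (fun j (n : ℕ∞) => expNeg ((e.symm j : ℝ≥0∞) * n))
    (fun j => measurable_of_countable _)
  rw [lintegral_prod_eq_prod_lintegral_of_indepFun Finset.univ
    (fun j ω => expNeg ((e.symm j : ℝ≥0∞) * pointCount U (f ⁻¹' {(e.symm j : ℝ≥0∞)}) ω)) hind'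
    (fun j => measurable_expNeg.comp
      ((measurable_pointCount hU.measurable (f.measurableSet_fiber _)).const_mul _))]
  refine Finset.prod_congr rfl fun j _ => ?_
  refine hU.lintegral_expNeg_count (f.measurableSet_fiber _) ?_ (hΛ _)
  obtain ⟨x, hx⟩ := SimpleFunc.mem_range.1 (e.symm j).2
  rw [← hx]; exact hf x

/-- The Laplace functional of a Poisson point process. -/
theorem IsPoissonPointProcess.lintegral_expNeg_tsum (hU : IsPoissonPointProcess U Λ P)
    [IsProbabilityMeasure P] [SigmaFinite Λ] {φ : E → ℝ≥0∞} (hφ : Measurable φ) :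
    ∫⁻ ω, expNeg (∑' i, φ (U i ω)) ∂P = expNeg (∫⁻ x, (1 - expNeg (φ x)) ∂Λ) := by
  -- Cutting off outside a set of finite intensity makes every nonzero fibre have finite intensity.
  let f : ℕ → SimpleFunc E ℝ≥0∞ := fun k => (SimpleFunc.eapprox φ k).restrict (spanningSets Λ k)
  have hfa : ∀ k x, f k x = (spanningSets Λ k).indicator (SimpleFunc.eapprox φ k) x := fun k x => by
    rw [SimpleFunc.restrict_apply _ (measurableSet_spanningSets Λ k)]
  have hmono : ∀ x, Monotone fun k => f k x := by
    intro x k l hkl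
    simp only [hfa]
    refine (Set.indicator_le_indicator_of_subset (monotone_spanningSets Λ hkl)
      (fun _ => zero_le) x).trans ?_
    exact Set.indicator_le_indicator (SimpleFunc.monotone_eapprox φ hkl x)
  have hlim : ∀ x, Tendsto (fun k => f k x) atTop (𝓝 (φ x)) := by
    intro x
    refine (SimpleFunc.tendsto_eapprox hφ x).congr' ?_
    filter_upwards [eventually_ge_atTop (spanningSetsIndex Λ x)] with k hk
    rw [hfa, Set.indicator_of_mem]
    exact monotone_spanningSets Λ hk (mem_spanningSetsIndex Λ x)
  have hk : ∀ k, ∫⁻ ω, expNeg (∑' i, f k (U i ω)) ∂P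
      = expNeg (∫⁻ x, (1 - expNeg (f k x)) ∂Λ) := by
    intro k
    refine hU.lintegral_expNeg_simpleFunc (f k) (fun x => ?_) (fun c hc => ?_)
    · rw [hfa]
      refine (lt_of_le_of_lt (Set.indicator_le_self' (fun _ _ => zero_le) x)
        (SimpleFunc.eapprox_lt_top φ k x)).ne
    · refine ((measure_mono fun x hx => ?_).trans_lt (measure_spanningSets_lt_top Λ k)).ne
      by_contra hxs
      have : f k x = 0 := by rw [hfa, Set.indicator_of_notMem hxs]
      exact hc (by rw [← hx, this])
  refine tendsto_nhds_unique (f := fun k => ∫⁻ ω, expNeg (∑' i, f k (U i ω)) ∂P) (l := atTop) ?_ ?_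
  · refine tendsto_lintegral_of_dominated_convergence (fun _ => 1) (fun k => ?_) (fun k => ?_)
      (by simp) (ae_of_all _ fun ω => ?_)
    · exact measurable_expNeg.comp
        (Measurable.tsum fun i => (f k).measurable.comp (hU.measurable i))
    · exact ae_of_all _ fun ω => expNeg_le_one _
    · refine (continuous_expNeg.tendsto _).comp ?_
      simp_rw [← lintegral_pointMeasure (f _).measurable, ← lintegral_pointMeasure hφ]
      exact lintegral_tendsto_of_tendsto_of_monotone (fun k => (f k).measurable.aemeasurable)
        (ae_of_all _ hmono) (ae_of_all _ hlim)
  · simp_rw [hk]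
    refine (continuous_expNeg.tendsto _).comp ?_
    refine lintegral_tendsto_of_tendsto_of_monotone (fun k => ?_) (ae_of_all _ fun x => ?_)
      (ae_of_all _ fun x => ?_)
    · exact (measurable_const.sub (measurable_expNeg.comp (f k).measurable)).aemeasurable
    · exact fun k l hkl => tsub_le_tsub_left (antitone_expNeg (hmono x hkl)) _
    · exact ENNReal.Tendsto.sub tendsto_const_nhds ((continuous_expNeg.tendsto _).comp (hlim x))
        (Or.inl ENNReal.one_ne_top)

/-- Campbell's formula for the mean of a sum over a Poisson point process. -/
theorem IsPoissonPointProcess.sum_map_eq (hU : IsPoissonPointProcess U Λ P)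
    [SigmaFinite Λ] : Measure.sum (fun i => P.map (U i)) = Λ := by
  have hfin : ∀ B, MeasurableSet B → Λ B ≠ ∞ → Measure.sum (fun i => P.map (U i)) B = Λ B := by
    intro B hB hΛ
    rw [Measure.sum_apply _ hB]
    have h1 : ∀ i, P.map (U i) B = ∫⁻ ω, B.indicator 1 (U i ω) ∂P := fun i => by
      rw [← lintegral_map (measurable_one.indicator hB) (hU.measurable i),
        lintegral_indicator_one hB]
    simp_rw [h1]
    rw [← lintegral_tsum (f := fun i ω => B.indicator 1 (U i ω)) fun i =>
      ((measurable_one.indicator hB).comp (hU.measurable i)).aemeasurable]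
    simp_rw [← lintegral_pointMeasure (U := U) (measurable_one.indicator hB),
      lintegral_indicator_one hB, pointMeasure_apply hB]
    rw [hU.lintegral_comp_count hB hΛ (fun n => n)]
    set r := (Λ B).toNNReal
    have hr : Λ B = r := (ENNReal.coe_toNNReal hΛ).symm
    rw [hr, poissonMeasure, lintegral_sum_measure]
    have h : HasSum (fun n : ℕ => Real.exp (-r) * r ^ n / n.factorial * n) (r : ℝ) := by
      -- The term n = 0 vanishes, and after the shift the factor n cancels against the factorial.
      rw [← hasSum_nat_add_iff' 1]
      have := (NormedSpace.expSeries_div_hasSum_exp (r : ℝ)).mul_left (Real.exp (-r) * r)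
      rw [← Real.exp_eq_exp_ℝ, mul_right_comm, ← Real.exp_add, neg_add_cancel, Real.exp_zero,
        one_mul] at this
      convert! this using 1
      · ext n
        rw [Nat.factorial_succ]
        push_cast
        field_simp
        ring
      · simp
    have h' : (r : ℝ≥0∞) = ∑' n : ℕ, ENNReal.ofReal (Real.exp (-r) * r ^ n / n.factorial * n) := by
      rw [← ENNReal.ofReal_tsum_of_nonneg (fun n => by positivity) h.summable, h.tsum_eq,
        ENNReal.ofReal_coe_nnreal]
    rw [h']
    refine tsum_congr fun n => ?_
    rw [lintegral_smul_measure, lintegral_dirac, smul_eq_mul, ENNReal.ofReal_mul (by positivity)]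
    simp
  ext B hB
  have hcov : ∀ (ν : Measure E), ν B = ⨆ n, ν (B ∩ spanningSets Λ n) := by
    intro ν
    rw [← Monotone.measure_iUnion, ← Set.inter_iUnion, iUnion_spanningSets, Set.inter_univ]
    exact fun k l hkl => Set.inter_subset_inter_right _ (monotone_spanningSets Λ hkl)
  rw [hcov, hcov Λ]
  refine iSup_congr fun n => hfin _ (hB.inter (measurableSet_spanningSets Λ n)) ?_
  exact ((measure_mono Set.inter_subset_right).trans_lt (measure_spanningSets_lt_top Λ n)).ne

end PointProcess

/-! ### Poisson processes with independent marks -/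

section MarkedPoisson

instance : SigmaFinite expIntensity := by
  unfold expIntensity; infer_instance

lemma expIntensity_Ioi (a : ℝ) : expIntensity (Set.Ioi a) = ENNReal.ofReal (Real.exp (-a)) := by
  rw [expIntensity, withDensity_apply _ measurableSet_Ioi, ← integral_exp_neg_Ioi a,
    ofReal_integral_eq_lintegral_ofReal (exp_neg_integrableOn_Ioi a one_pos |>.congr (by simp))
      (ae_of_all _ fun x => (Real.exp_pos _).le)]

/-- The set is the ray u > -log v, of mass e^{log v}. This is how the intensity e^{-x} turns void
probabilities into exponentials of mean marks. -/
lemma expIntensity_mul_gt_one (v : ℝ≥0∞) :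
    expIntensity {u | 1 < ENNReal.ofReal (Real.exp u) * v} = v := by
  have hfin : ∀ r : ℝ, 0 < r → {u : ℝ | 1 < ENNReal.ofReal (Real.exp u) * ENNReal.ofReal r}
      = Set.Ioi (-Real.log r) := by
    intro r hr
    ext u
    rw [Set.mem_ofPred_eq, ← ENNReal.ofReal_mul (Real.exp_pos _).le, ENNReal.one_lt_ofReal,
      Set.mem_Ioi, ← Real.log_lt_log_iff one_pos (by positivity), Real.log_one,
      Real.log_mul (Real.exp_ne_zero _) hr.ne', Real.log_exp]
    constructor <;> intro h <;> linarith
  have hval : ∀ r : ℝ, 0 < r →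
      expIntensity {u : ℝ | 1 < ENNReal.ofReal (Real.exp u) * ENNReal.ofReal r}
      = ENNReal.ofReal r := by
    intro r hr
    rw [hfin r hr, expIntensity_Ioi, neg_neg, Real.exp_log hr]
  rcases eq_or_ne v 0 with rfl | h0
  · simp
  rcases eq_or_ne v ∞ with rfl | htop
  · refine ENNReal.eq_top_of_forall_nnreal_le fun r => ?_
    refine le_trans ?_ ((hval (r + 1) (by positivity)).symm.le.trans (measure_mono fun u hu => ?_))
    · rw [ENNReal.ofReal_add r.coe_nonneg zero_le_one, ENNReal.ofReal_coe_nnreal]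
      exact le_self_add
    · refine lt_of_lt_of_le (Set.mem_ofPred_eq ▸ hu) ?_
      gcongr
      exact le_top
  · have := hval v.toReal (ENNReal.toReal_pos h0 htop)
    rwa [ENNReal.ofReal_toReal htop] at this

variable {Ω S : Type*} [MeasurableSpace Ω] [MeasurableSpace S] {P : Measure Ω}
  [IsProbabilityMeasure P] {U : ℕ → Ω → ℝ} {Y : ℕ → Ω → S} {ν : Measure S}

/-- Condition on the points: the marks remain independent with law ν. Infinitely many marks are
reached later by monotone limits. -/
lemma measure_forall_lt_eq_lintegral_prod [IsProbabilityMeasure ν]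
    (hU : ∀ i, Measurable (U i)) (hY : ∀ i, Measurable (Y i)) (hν : ∀ i, P.map (Y i) = ν)
    (hind : iIndepFun Y P) (hUY : IndepFun (fun ω i => U i ω) (fun ω i => Y i ω) P)
    {C : Set (ℝ × S)} (hC : MeasurableSet C) (n : ℕ) :
    P {ω | ∀ i < n, (U i ω, Y i ω) ∈ C}
      = ∫⁻ ω, ∏ i ∈ Finset.range n, ν (Prod.mk (U i ω) ⁻¹' C) ∂P := by
  have hU' : Measurable fun ω i => U i ω := measurable_pi_lambda _ hU
  have hY' : Measurable fun ω i => Y i ω := measurable_pi_lambda _ hY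
  let D : Set ((ℕ → ℝ) × (ℕ → S)) := {p | ∀ i < n, (p.1 i, p.2 i) ∈ C}
  have hD : MeasurableSet D := by
    have : D = ⋂ i, ⋂ (_ : i < n), (fun p : (ℕ → ℝ) × (ℕ → S) => (p.1 i, p.2 i)) ⁻¹' C := by
      ext p; simp [D]
    rw [this]
    exact MeasurableSet.iInter fun i => MeasurableSet.iInter fun _ =>
      (by fun_prop : Measurable fun p : (ℕ → ℝ) × (ℕ → S) => (p.1 i, p.2 i)) hC
  have h1 : P {ω | ∀ i < n, (U i ω, Y i ω) ∈ C}
      = P.map (fun ω => ((fun i => U i ω), (fun i => Y i ω))) D := by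
    rw [Measure.map_apply (hU'.prodMk hY') hD]; rfl
  have := Measure.isProbabilityMeasure_map (μ := P) hY'.aemeasurable
  rw [h1, (indepFun_iff_map_prod_eq_prod_map_map hU'.aemeasurable hY'.aemeasurable).1 hUY,
    Measure.prod_apply hD, lintegral_map (measurable_measure_prodMk_left hD) hU']
  refine lintegral_congr fun ω => ?_
  rw [Measure.map_apply hY' (measurable_prodMk_left hD)]
  have h2 : (fun ω i => Y i ω) ⁻¹' (Prod.mk (fun i => U i ω) ⁻¹' D)
      = ⋂ i ∈ Finset.range n, Y i ⁻¹' (Prod.mk (U i ω) ⁻¹' C) := by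
    ext ω'; simp [D]
  rw [h2, hind.measure_inter_preimage_eq_mul _ (fun i _ => measurable_prodMk_left hC)]
  refine Finset.prod_congr rfl fun i _ => ?_
  rw [← hν i, Measure.map_apply (hY i) (measurable_prodMk_left hC)]

/-- The void probabilities of an independently marked Poisson process with intensity
`e^{-x} dx`. -/
theorem measure_forall_exp_mul_le_one [IsProbabilityMeasure ν]
    (hU : IsPoissonPointProcess U expIntensity P) (hY : ∀ i, Measurable (Y i))
    (hν : ∀ i, P.map (Y i) = ν) (hind : iIndepFun Y P)
    (hUY : IndepFun (fun ω i => U i ω) (fun ω i => Y i ω) P)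
    {V : S → ℝ≥0∞} (hV : Measurable V) :
    P {ω | ∀ i, ENNReal.ofReal (Real.exp (U i ω)) * V (Y i ω) ≤ 1}
      = expNeg (∫⁻ y, V y ∂ν) := by
  let C : Set (ℝ × S) := {p | ENNReal.ofReal (Real.exp p.1) * V p.2 ≤ 1}
  have hC : MeasurableSet C := by
    refine measurableSet_le (Measurable.mul ?_ (hV.comp measurable_snd)) measurable_const
    exact (Real.measurable_exp.comp measurable_fst).ennreal_ofReal
  let G : ℝ → ℝ≥0∞ := fun u => ν (Prod.mk u ⁻¹' C)
  have hG : Measurable G := measurable_measure_prodMk_left hC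
  -- The conditional probability that a point at u satisfies the constraint is e^{-φ(u)}, so the
  -- void probability is the Laplace functional at φ.
  let φ : ℝ → ℝ≥0∞ := fun u => (-(ENNReal.log (G u))).toENNReal
  have hφ : Measurable φ := by
    have : Measurable fun u => -(ENNReal.log (G u)) :=
      continuous_neg.measurable.comp (ENNReal.measurable_log.comp hG)
    exact this.ereal_toENNReal
  have hφG : ∀ u, expNeg (φ u) = G u := fun u => exists_expNeg_eq prob_le_one
  have hlim1 : Tendsto (fun n => P {ω | ∀ i < n, (U i ω, Y i ω) ∈ C}) atTop
      (𝓝 (P {ω | ∀ i, (U i ω, Y i ω) ∈ C})) := by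
    have : {ω | ∀ i, (U i ω, Y i ω) ∈ C} = ⋂ n, {ω | ∀ i < n, (U i ω, Y i ω) ∈ C} := by
      ext ω
      simp only [Set.mem_iInter, Set.mem_ofPred_eq]
      exact ⟨fun h n i _ => h i, fun h i => h (i + 1) i (Nat.lt_succ_self i)⟩
    rw [this]
    refine tendsto_measure_iInter_atTop (fun n => ?_) (fun k l hkl ω h i hi =>
      h i (hi.trans_le hkl)) ⟨0, measure_ne_top _ _⟩
    have : {ω | ∀ i < n, (U i ω, Y i ω) ∈ C}
        = ⋂ i, ⋂ (_ : i < n), (fun ω => (U i ω, Y i ω)) ⁻¹' C := by ext; simp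
    rw [this]
    exact (MeasurableSet.iInter fun i => MeasurableSet.iInter fun _ =>
      ((hU.measurable i).prodMk (hY i)) hC).nullMeasurableSet
  have hlim2 : Tendsto (fun n => P {ω | ∀ i < n, (U i ω, Y i ω) ∈ C}) atTop
      (𝓝 (∫⁻ ω, expNeg (∑' i, φ (U i ω)) ∂P)) := by
    simp_rw [measure_forall_lt_eq_lintegral_prod hU.measurable hY hν hind hUY hC]
    have : ∀ ω n, ∏ i ∈ Finset.range n, ν (Prod.mk (U i ω) ⁻¹' C)
        = expNeg (∑ i ∈ Finset.range n, φ (U i ω)) := fun ω n => by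
      rw [expNeg_sum]; exact Finset.prod_congr rfl fun i _ => (hφG _).symm
    simp_rw [this]
    refine tendsto_lintegral_of_dominated_convergence (fun _ => 1) (fun n => ?_) (fun n => ?_)
      (by simp) (ae_of_all _ fun ω => ?_)
    · exact measurable_expNeg.comp
        (Finset.measurable_sum _ fun i _ => hφ.comp (hU.measurable i))
    · exact ae_of_all _ fun ω => expNeg_le_one _
    · exact (continuous_expNeg.tendsto _).comp ENNReal.summable.hasSum.tendsto_sum_nat
  rw [show {ω | ∀ i, ENNReal.ofReal (Real.exp (U i ω)) * V (Y i ω) ≤ 1}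
    = {ω | ∀ i, (U i ω, Y i ω) ∈ C} from rfl, tendsto_nhds_unique hlim1 hlim2,
    hU.lintegral_expNeg_tsum hφ]
  congr 1
  have h3 : ∀ u, 1 - expNeg (φ u) = ν (Prod.mk u ⁻¹' Cᶜ) := fun u => by
    rw [hφG, Set.preimage_compl, prob_compl_eq_one_sub (measurable_prodMk_left hC)]
  simp_rw [h3]
  -- Tonelli: integrate over the point first, with the mark y fixed; the result is V(y).
  rw [← Measure.prod_apply hC.compl, Measure.prod_apply_symm hC.compl]
  refine lintegral_congr fun y => ?_
  rw [← expIntensity_mul_gt_one (V y)]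
  congr 1
  ext u
  simp [C]

/-- Almost surely only finitely many terms of an independently marked Poisson process exceed a
given level, provided that the marks have finite mean. -/
theorem ae_finite_exp_mul_gt_one (hU : IsPoissonPointProcess U expIntensity P)
    (hY : ∀ i, Measurable (Y i)) [SFinite ν]
    (hν : ∀ i, P.map (Y i) = ν) (hUY : ∀ i, IndepFun (U i) (Y i) P)
    {V : S → ℝ≥0∞} (hV : Measurable V) (hfin : ∫⁻ y, V y ∂ν ≠ ∞) :
    ∀ᵐ ω ∂P, {i | 1 < ENNReal.ofReal (Real.exp (U i ω)) * V (Y i ω)}.Finite := by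
  let C : Set (ℝ × S) := {p | 1 < ENNReal.ofReal (Real.exp p.1) * V p.2}
  have hC : MeasurableSet C := by
    refine measurableSet_lt measurable_const (Measurable.mul ?_ (hV.comp measurable_snd))
    exact (Real.measurable_exp.comp measurable_fst).ennreal_ofReal
  -- Borel–Cantelli: by Campbell's formula the probabilities sum to the mean mark, which is finite.
  refine ae_finite_setOfPred_mem (μ := P) (s := fun i => {ω | (U i ω, Y i ω) ∈ C}) ?_
  have h1 : ∀ i, P {ω | (U i ω, Y i ω) ∈ C} = ((P.map (U i)).prod ν) C := by
    intro i
    rw [← hν i, ← (indepFun_iff_map_prod_eq_prod_map_map (hU.measurable i).aemeasurable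
      (hY i).aemeasurable).1 (hUY i), Measure.map_apply ((hU.measurable i).prodMk (hY i)) hC]
    rfl
  have h2 : ∑' i, P {ω | (U i ω, Y i ω) ∈ C} = ∫⁻ y, V y ∂ν := by
    simp_rw [h1, Measure.prod_apply hC]
    rw [← lintegral_sum_measure, hU.sum_map_eq, ← Measure.prod_apply hC,
      Measure.prod_apply_symm hC]
    exact lintegral_congr fun y => expIntensity_mul_gt_one (V y)
  rwa [h2]

end MarkedPoisson

/-! ### Cameron–Martin for Gaussian processes -/

section Gaussian

/-- Completing the square: e^{z-v/2} times the N(0, v) density is the N(v, v) density. For v = 0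
both laws are the Dirac mass at 0. -/
lemma lintegral_exp_mul_gaussianReal (v : ℝ≥0) {F : ℝ → ℝ≥0∞} (hF : Measurable F) :
    ∫⁻ z, ENNReal.ofReal (Real.exp (z - v / 2)) * F z ∂(gaussianReal 0 v)
      = ∫⁻ z, F (z + v) ∂(gaussianReal 0 v) := by
  rw [← lintegral_map hF (measurable_add_const (v : ℝ)), gaussianReal_map_add_const, zero_add]
  rcases eq_or_ne v 0 with rfl | hv
  · simp [lintegral_dirac]
  have hv' : (v : ℝ) ≠ 0 := by exact_mod_cast hv
  rw [gaussianReal_of_var_ne_zero _ hv, gaussianReal_of_var_ne_zero _ hv,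
    lintegral_withDensity_eq_lintegral_mul _ (measurable_gaussianPDF _ _) (by fun_prop),
    lintegral_withDensity_eq_lintegral_mul _ (measurable_gaussianPDF _ _) hF]
  refine lintegral_congr fun z => ?_
  simp only [Pi.mul_apply]
  rw [← mul_assoc]
  congr 1
  rw [gaussianPDF, gaussianPDF, ← ENNReal.ofReal_mul (gaussianPDFReal_nonneg _ _ _),
    gaussianPDFReal, gaussianPDFReal, mul_assoc, ← Real.exp_add]
  congr 3
  field_simp
  ring

variable {Ω : Type*} [MeasurableSpace Ω] {P : Measure Ω} [IsProbabilityMeasure P]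

lemma sq_covariance_le {X Y : Ω → ℝ} (hX : MemLp X 2 P) (hY : MemLp Y 2 P) :
    cov[X, Y; P] ^ 2 ≤ Var[X; P] * Var[Y; P] := by
  have h : ∀ x : ℝ, 0 ≤ Var[Y; P] * (x * x) + (2 * cov[X, Y; P]) * x + Var[X; P] := by
    intro x
    have h1 := variance_nonneg (X + x • Y) P
    rw [variance_add hX (hY.const_smul x), variance_smul, covariance_smul_right] at h1
    linarith
  have := discrim_le_zero h
  rw [discrim] at this
  linarith

/-- The Cameron--Martin formula for the shift of a centered Gaussian process in the direction
of the covariance with one of its values. -/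
theorem lintegral_exp_mul_gaussianProcess {T : Type*} {X : T → Ω → ℝ} (hX : IsGaussianProcess X P)
    (hm : ∀ t, Measurable (X t)) (h0 : ∀ t, ∫ ω, X t ω ∂P = 0) (s : T)
    {F : (T → ℝ) → ℝ≥0∞} (hF : Measurable F) :
    ∫⁻ ω, ENNReal.ofReal (Real.exp (X s ω - Var[X s; P] / 2)) * F (fun t => X t ω) ∂P
      = ∫⁻ ω, F (fun t => X t ω + cov[X t, X s; P]) ∂P := by
  have hL2 : ∀ t, MemLp (X t) 2 P := fun t => (hX.hasGaussianLaw_eval t).memLp_two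
  set v : ℝ≥0 := Var[X s; P].toNNReal with hv
  have hvr : (v : ℝ) = Var[X s; P] := Real.coe_toNNReal _ (variance_nonneg _ _)
  -- Regression coefficient on X s. The residuals R are uncorrelated with X s, hence independent of
  -- it by joint Gaussianity, so the tilt acts on X s alone. If v = 0, division gives 0, and the
  -- covariance vanishes too by Cauchy–Schwarz.
  let c : T → ℝ := fun t => cov[X t, X s; P] / v
  have hc : ∀ t, c t * v = cov[X t, X s; P] := by
    intro t
    rcases eq_or_ne (v : ℝ) 0 with h | h
    · have h2 := sq_covariance_le (hL2 t) (hL2 s)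
      rw [← hvr, h, mul_zero] at h2
      rw [h, mul_zero, eq_comm]
      exact pow_eq_zero_iff two_ne_zero |>.1 (le_antisymm h2 (sq_nonneg _))
    · exact div_mul_cancel₀ _ h
  let R : T → Ω → ℝ := fun t ω => X t ω - c t * X s ω
  have hR : ∀ t, Measurable (R t) := fun t => (hm t).sub ((hm s).const_mul _)
  have hgauss : IsGaussianProcess (Sum.elim R (fun _ : Unit => X s)) P := by
    classical
    refine hX.of_isGaussianProcess fun p => ?_
    rcases p with t | u
    · refine ⟨{t, s}, ContinuousLinearMap.proj (⟨t, by simp⟩ : ({t, s} : Finset T))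
        - c t • ContinuousLinearMap.proj (⟨s, by simp⟩ : ({t, s} : Finset T)), fun ω => ?_⟩
      simp [R]
    · exact ⟨{s}, ContinuousLinearMap.proj (⟨s, by simp⟩ : ({s} : Finset T)), fun ω => by simp⟩
  have hind := hgauss.indepFun_of_covariance_eq_zero (fun t => (hR t).aemeasurable)
    (fun _ => (hm s).aemeasurable) (fun t _ => by
      have : cov[R t, X s; P] = cov[X t - c t • X s, X s; P] := rfl
      rw [this, covariance_sub_left (hL2 t) ((hL2 s).const_smul _) (hL2 s), covariance_smul_left,
        covariance_self (hm s).aemeasurable, ← hvr, hc, sub_self])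
  have hRm : Measurable fun ω t => R t ω := measurable_pi_lambda _ hR
  have hind' : IndepFun (fun ω t => R t ω) (X s) P :=
    hind.comp measurable_id (measurable_pi_apply (X := fun _ : Unit => ℝ) ())
  have hlaw : P.map (X s) = gaussianReal 0 v := by
    rw [(hX.hasGaussianLaw_eval s).map_eq_gaussianReal, h0]
  have hmap := (indepFun_iff_map_prod_eq_prod_map_map hRm.aemeasurable (hm s).aemeasurable).1 hind'
  have key : ∀ f : (T → ℝ) × ℝ → ℝ≥0∞, Measurable f → ∫⁻ ω, f (fun t => R t ω, X s ω) ∂P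
      = ∫⁻ r, ∫⁻ z, f (r, z) ∂(gaussianReal 0 v) ∂(P.map fun ω t => R t ω) := by
    intro f hf
    rw [← lintegral_map hf (hRm.prodMk (hm s)), hmap, hlaw, lintegral_prod _ hf.aemeasurable]
  have hS : Measurable fun p : (T → ℝ) × ℝ => F fun t => p.1 t + c t * p.2 :=
    hF.comp (measurable_pi_lambda _ fun t => by fun_prop)
  have hS' : Measurable fun p : (T → ℝ) × ℝ => F fun t => p.1 t + c t * (p.2 + v) :=
    hF.comp (measurable_pi_lambda _ fun t => by fun_prop)
  have h1 := key (fun p => ENNReal.ofReal (Real.exp (p.2 - v / 2)) * F fun t => p.1 t + c t * p.2)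
    (Measurable.mul (by fun_prop) hS)
  have h2 := key (fun p => F fun t => p.1 t + c t * (p.2 + v)) hS'
  have h3 : ∀ r : T → ℝ, ∫⁻ z, ENNReal.ofReal (Real.exp (z - v / 2)) * (F fun t => r t + c t * z)
      ∂(gaussianReal 0 v) = ∫⁻ z, F (fun t => r t + c t * (z + v)) ∂(gaussianReal 0 v) := fun r =>
    lintegral_exp_mul_gaussianReal v (F := fun z => F fun t => r t + c t * z)
      (hS.comp measurable_prodMk_left)
  simp only [h3] at h1
  rw [← h2] at h1
  simp only [R, sub_add_cancel, mul_add, ← add_assoc] at h1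
  simp only [hc] at h1
  simp only [hvr] at h1
  exact h1

end Gaussian

/-! ### The variance function and translation invariance -/

section StationaryIncrements

variable {Ω : Type*} [MeasurableSpace Ω] {P : Measure Ω} {W : ℝ → Ω → ℝ}

namespace IsGaussianStatIncr

lemma measurable_path (hW : IsGaussianStatIncr W P) : Measurable fun ω t => W t ω :=
  measurable_pi_lambda _ hW.measurable

lemma memLp_two (hW : IsGaussianStatIncr W P) (t : ℝ) : MemLp (W t) 2 P :=
  (hW.gaussian.hasGaussianLaw_eval t).memLp_two

lemma map_eq (hW : IsGaussianStatIncr W P) (t : ℝ) :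
    P.map (W t) = gaussianReal 0 Var[W t; P].toNNReal := by
  rw [(hW.gaussian.hasGaussianLaw_eval t).map_eq_gaussianReal, hW.mean_zero]

lemma identDistrib_increment (hW : IsGaussianStatIncr W P) (s : ℝ) :
    IdentDistrib (fun ω (t : ℝ) => W (t + s) ω - W s ω) (fun ω t => W t ω) P P := by
  refine (hW.stat_incr s).trans (IdentDistrib.of_ae_eq ?_ ?_)
  · exact (measurable_pi_lambda _ fun t =>
      (hW.measurable t).sub (hW.measurable 0)).aemeasurable
  · filter_upwards [hW.zero_at_zero] with ω hω
    ext t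
    simp [hω]

lemma variance_increment (hW : IsGaussianStatIncr W P) (s t : ℝ) :
    Var[W (t + s) - W s; P] = Var[W t; P] :=
  ((hW.identDistrib_increment s).comp (measurable_pi_apply t)).variance_eq

lemma variance_zero (hW : IsGaussianStatIncr W P) : Var[W 0; P] = 0 := by
  rw [variance_congr hW.zero_at_zero, ProbabilityTheory.variance_zero]

/-- Each W t is a multiple of a standard normal N: if its variance is at least ε, then |W t| ≥ √ε
with probability at least P(|N| ≥ 1) > 0, which stochastic continuity excludes near 0. -/
lemma tendsto_variance_zero (hW : IsGaussianStatIncr W P) :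
    Tendsto (fun t => Var[W t; P]) (𝓝 0) (𝓝 0) := by
  set p := gaussianReal 0 1 {x : ℝ | 1 ≤ |x|} with hp
  have hp0 : 0 < p := by
    rw [pos_iff_ne_zero]
    intro h
    have h1 := gaussianReal_absolutelyContinuous' 0 one_ne_zero h
    have h2 : volume (Set.Icc (1 : ℝ) 2) ≤ volume {x : ℝ | 1 ≤ |x|} :=
      measure_mono fun x hx => hx.1.trans (le_abs_self x)
    rw [h1, Real.volume_Icc] at h2
    norm_num at h2
  rw [Metric.tendsto_nhds]
  intro ε hε
  have h := hW.stoch_cont 0 (ENNReal.ofReal √ε) (ENNReal.ofReal_pos.2 (Real.sqrt_pos.2 hε))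
  filter_upwards [(tendsto_order.1 h).2 p hp0] with t ht
  rw [Real.dist_eq, sub_zero, abs_of_nonneg (variance_nonneg _ _)]
  by_contra! hle
  refine absurd ht (not_lt.2 ?_)
  have hmap : P.map (W t) = (gaussianReal 0 1).map (fun x => √Var[W t; P] * x) := by
    rw [hW.map_eq, gaussianReal_map_const_mul]
    congr 1
    · simp
    · ext
      simp [Real.sq_sqrt (variance_nonneg _ _), Real.coe_toNNReal _ (variance_nonneg _ _)]
  have hms : MeasurableSet {x : ℝ | √ε ≤ |x|} :=
    measurableSet_le measurable_const measurable_norm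
  have h1 : P {ω | ENNReal.ofReal √ε ≤ edist (W t ω) (W 0 ω)} = P.map (W t) {x | √ε ≤ |x|} := by
    rw [Measure.map_apply (hW.measurable t) hms]
    refine measure_congr (Filter.eventuallyEq_set.2 ?_)
    filter_upwards [hW.zero_at_zero] with ω hω
    change ENNReal.ofReal √ε ≤ edist (W t ω) (W 0 ω) ↔ √ε ≤ |W t ω|
    rw [hω, edist_dist, Pi.zero_apply, Real.dist_eq, sub_zero,
      ENNReal.ofReal_le_ofReal_iff (abs_nonneg _)]
  rw [h1, hmap, Measure.map_apply (by fun_prop) hms]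
  refine measure_mono fun x hx => ?_
  change √ε ≤ |√Var[W t; P] * x|
  rw [abs_mul, abs_of_nonneg (Real.sqrt_nonneg _)]
  calc √ε ≤ √Var[W t; P] := Real.sqrt_le_sqrt hle
    _ ≤ √Var[W t; P] * |x| := le_mul_of_one_le_right (Real.sqrt_nonneg _) hx

variable [IsProbabilityMeasure P]

lemma covariance_increment (hW : IsGaussianStatIncr W P) (s t : ℝ) :
    cov[W (t + s) - W s, W s; P] = (Var[W (t + s); P] - Var[W s; P] - Var[W t; P]) / 2 := by
  have h := variance_add ((hW.memLp_two (t + s)).sub (hW.memLp_two s)) (hW.memLp_two s)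
  rw [sub_add_cancel, hW.variance_increment] at h
  linarith

lemma variance_neg (hW : IsGaussianStatIncr W P) (t : ℝ) : Var[W (-t); P] = Var[W t; P] := by
  have h := hW.variance_increment (-t) t
  rw [← h, add_neg_cancel, variance_sub (hW.memLp_two 0) (hW.memLp_two (-t)), hW.variance_zero]
  have h2 := sq_covariance_le (hW.memLp_two 0) (hW.memLp_two (-t))
  rw [hW.variance_zero, zero_mul] at h2
  rw [pow_eq_zero_iff two_ne_zero |>.1 (le_antisymm h2 (sq_nonneg _))]
  ring

/-- The inequality (a+b)² ≤ 2a² + 2b² for the increment and W s. This quasi-triangle inequality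
drives the density argument. -/
lemma variance_add_le (hW : IsGaussianStatIncr W P) (s t : ℝ) :
    Var[W (t + s); P] ≤ 2 * Var[W t; P] + 2 * Var[W s; P] := by
  have h1 := variance_add ((hW.memLp_two (t + s)).sub (hW.memLp_two s)) (hW.memLp_two s)
  have h2 := variance_sub ((hW.memLp_two (t + s)).sub (hW.memLp_two s)) (hW.memLp_two s)
  rw [sub_add_cancel] at h1
  rw [hW.variance_increment] at h1 h2
  have := variance_nonneg (W (t + s) - W s - W s) P
  linarith

lemma continuous_variance (hW : IsGaussianStatIncr W P) : Continuous fun t => Var[W t; P] := by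
  rw [continuous_iff_continuousAt]
  intro t
  have hbound : ∀ h, |Var[W (h + t); P] - Var[W t; P]|
      ≤ Var[W h; P] + 2 * √(Var[W h; P] * Var[W t; P]) := by
    intro h
    have h1 := hW.covariance_increment t h
    have h2 := sq_covariance_le ((hW.memLp_two (h + t)).sub (hW.memLp_two t)) (hW.memLp_two t)
    rw [hW.variance_increment] at h2
    have h3 := abs_le.1 (Real.abs_le_sqrt h2)
    have := variance_nonneg (W h) P
    rw [abs_le]
    constructor <;> linarith [h3.1, h3.2]
  have hlim : Tendsto (fun h => Var[W h; P] + 2 * √(Var[W h; P] * Var[W t; P])) (𝓝 0) (𝓝 0) := by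
    have h1 := hW.tendsto_variance_zero
    have h2 := (Real.continuous_sqrt.tendsto _).comp (h1.mul_const Var[W t; P])
    simpa using h1.add (h2.const_mul 2)
  have h := squeeze_zero_norm (f := fun h => Var[W (h + t); P] - Var[W t; P]) hbound hlim
  rw [tendsto_sub_nhds_zero_iff] at h
  have hsub : Tendsto (fun s : ℝ => s - t) (𝓝 t) (𝓝 0) := by
    simpa using (continuous_sub_right t).tendsto t
  simpa [ContinuousAt, Function.comp_def] using h.comp hsub

/-- Invariance of the exponent measure of a Brown--Resnick process. -/
theorem lintegral_shift_eq (hW : IsGaussianStatIncr W P) (s : ℝ) {G : (ℝ → ℝ) → ℝ≥0∞}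
    (hG : Measurable G)
    (hhom : ∀ x c, G (fun t => x t + c) = ENNReal.ofReal (Real.exp c) * G x) :
    ∫⁻ ω, G (fun t => W (t + s) ω - Var[W (t + s); P] / 2) ∂P
      = ∫⁻ ω, G (fun t => W t ω - Var[W t; P] / 2) ∂P := by
  -- `none` carries W s, whose exponential factors out by homogeneity and serves as the tilt; `some
  -- t` carries the increment. The covariance shift turns the drift -(σ²(t+s) - σ²(s))/2 into
  -- -σ²(t)/2, and stationarity of increments finishes.
  let X : Option ℝ → Ω → ℝ := fun o => o.elim (W s) fun t => W (t + s) - W s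
  have hXm : ∀ o, Measurable (X o) := by
    rintro (_ | t)
    · exact hW.measurable s
    · exact (hW.measurable (t + s)).sub (hW.measurable s)
  have hX0 : ∀ o, ∫ ω, X o ω ∂P = 0 := by
    rintro (_ | t)
    · exact hW.mean_zero s
    · simp only [X, Option.elim, Pi.sub_apply]
      rw [integral_sub ((hW.memLp_two _).integrable one_le_two)
        ((hW.memLp_two _).integrable one_le_two), hW.mean_zero, hW.mean_zero, sub_zero]
  have hX : IsGaussianProcess X P := by
    classical
    refine hW.gaussian.of_isGaussianProcess ?_
    rintro (_ | t)
    · exact ⟨{s}, ContinuousLinearMap.proj (⟨s, by simp⟩ : ({s} : Finset ℝ)), fun ω => by simp [X]⟩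
    · refine ⟨{t + s, s}, ContinuousLinearMap.proj (⟨t + s, by simp⟩ : ({t + s, s} : Finset ℝ))
        - (1 : ℝ) • ContinuousLinearMap.proj (⟨s, by simp⟩ : ({t + s, s} : Finset ℝ)),
        fun ω => ?_⟩
      simp [X]
  have hsh : Measurable fun (x : Option ℝ → ℝ) (t : ℝ) =>
      x (some t) - (Var[W (t + s); P] - Var[W s; P]) / 2 :=
    measurable_pi_lambda _ fun t => by fun_prop
  have h := lintegral_exp_mul_gaussianProcess hX hXm hX0 none
    (F := fun x => G fun t => x (some t) - (Var[W (t + s); P] - Var[W s; P]) / 2) (hG.comp hsh)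
  simp only [X, Option.elim, Pi.sub_apply, hW.covariance_increment] at h
  have hl : ∀ ω, G (fun t => W (t + s) ω - Var[W (t + s); P] / 2)
      = ENNReal.ofReal (Real.exp (W s ω - Var[W s; P] / 2)) *
        G fun t => W (t + s) ω - W s ω - (Var[W (t + s); P] - Var[W s; P]) / 2 := by
    intro ω
    rw [← hhom]
    congr 1
    ext t
    ring
  simp_rw [hl]
  rw [h]
  have hid := ((hW.identDistrib_increment s).comp (u := fun x => G fun t => x t - Var[W t; P] / 2)
    (hG.comp (measurable_pi_lambda _ fun t => by fun_prop))).lintegral_eq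
  simp only [Function.comp_def] at hid
  rw [← hid]
  refine lintegral_congr fun ω => ?_
  congr 1
  ext t
  ring

end IsGaussianStatIncr

end StationaryIncrements

/-! ### Density of sublevel sets -/

section Density

lemma upperDensity_le_of_eventually {D : Set ℝ} {c : ℝ} (hc : 0 ≤ c)
    (h : ∀ᶠ T : ℝ in atTop, volume (D ∩ Set.Icc 0 T) ≤ ENNReal.ofReal (c * T)) :
    upperDensity D ≤ ENNReal.ofReal c := by
  refine limsup_le_of_le (h := ?_)
  filter_upwards [h, eventually_gt_atTop 0] with T hT hT0
  refine ENNReal.div_le_of_le_mul ?_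
  rwa [← ENNReal.ofReal_mul hc]

lemma upperDensity_ge_of_eventually {D : Set ℝ} {c : ℝ} (hc : 0 ≤ c)
    (h : ∀ᶠ T : ℝ in atTop, ENNReal.ofReal (c * T) ≤ volume (D ∩ Set.Icc 0 T)) :
    ENNReal.ofReal c ≤ upperDensity D := by
  refine le_limsup_of_frequently_le (Eventually.frequently ?_)
  filter_upwards [h, eventually_gt_atTop 0] with T hT hT0
  rw [ENNReal.le_div_iff_mul_le (Or.inl (ENNReal.ofReal_pos.2 hT0).ne')
    (Or.inl ENNReal.ofReal_ne_top), ← ENNReal.ofReal_mul hc]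
  exact hT

variable {f : ℝ → ℝ}

/-- Unbounded functions with a quasi-triangle inequality have sequences with large differences. -/
lemma exists_seq_separated (hadd : ∀ s t, f (t + s) ≤ 2 * f t + 2 * f s)
    (hunb : ∀ R, ∃ t, R < f t) (R : ℝ) :
    ∃ a : ℕ → ℝ, ∀ m n, m < n → R < f (a n - a m) := by
  obtain ⟨a, -, ha⟩ := exists_seq_of_forall_finset_exists (fun _ : ℝ => True)
    (fun x y => R < f (y - x)) (fun s _ => by
      obtain ⟨B, hB⟩ := (s.finite_toSet.image f).bddAbove
      -- From f(y) ≤ 2f(y-x) + 2f(x) and f(x) ≤ B it follows that f(y-x) > R.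
      obtain ⟨y, hy⟩ := hunb (2 * R + 2 * B)
      refine ⟨y, trivial, fun x hx => ?_⟩
      have h1 := hadd x (y - x)
      rw [sub_add_cancel] at h1
      have h2 : f x ≤ B := hB ⟨x, hx, rfl⟩
      linarith)
  exact ⟨a, ha⟩

/-- A sublevel set of positive density has a syndetic difference set, so that unboundedness forces
sublevel sets to have density zero. -/
lemma eventually_volume_sublevel_le (hf : Continuous f) (hneg : ∀ t, f (-t) = f t)
    (hadd : ∀ s t, f (t + s) ≤ 2 * f t + 2 * f s) (hunb : ∀ R, ∃ t, R < f t) (R : ℝ) {c : ℝ}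
    (hc : 0 < c) :
    ∀ᶠ T : ℝ in atTop, volume ({t | 0 ≤ t ∧ f t ≤ R} ∩ Set.Icc 0 T) ≤ ENNReal.ofReal (c * T) := by
  -- If x - a i and x - a j both lay in the sublevel set, then f(a j - a i) ≤ 2R + 2R; so its
  -- translates by the a i are disjoint.
  obtain ⟨a, ha⟩ := exists_seq_separated hadd hunb (4 * R)
  -- The n disjoint translates fit in an interval of length T + 2S ≤ 2T, so each has volume at most
  -- 2T/n ≤ cT.
  obtain ⟨n, hn⟩ := exists_nat_gt (2 / c)
  have hn0 : (0 : ℝ) < n := (by positivity : 0 < 2 / c).trans hn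
  set S : ℝ := ∑ i ∈ Finset.range n, |a i| with hS
  have hS0 : 0 ≤ S := Finset.sum_nonneg fun i _ => abs_nonneg _
  filter_upwards [eventually_ge_atTop (2 * S), eventually_ge_atTop 0] with T hT hT0
  set K : Set ℝ := {t | 0 ≤ t ∧ f t ≤ R} ∩ Set.Icc 0 T with hK
  have hKm : MeasurableSet K :=
    ((measurableSet_le measurable_const measurable_id).inter
      (measurableSet_le hf.measurable measurable_const)).inter measurableSet_Icc
  have hdisj : (Finset.range n : Set ℕ).PairwiseDisjoint fun i => (fun x => x - a i) ⁻¹' K := by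
    have key : ∀ i j, i < j →
        Disjoint ((fun x => x - a i) ⁻¹' K) ((fun x => x - a j) ⁻¹' K) := by
      intro i j hij
      refine Set.disjoint_left.2 fun x hx hy => ?_
      have h1 := hadd (-(x - a j)) (x - a i)
      have h2 : x - a i + -(x - a j) = a j - a i := by ring
      rw [h2, hneg] at h1
      have := ha i j hij
      have h3 : f (x - a i) ≤ R := hx.1.2
      have h4 : f (x - a j) ≤ R := hy.1.2
      linarith
    intro i _ j _ hij
    rcases lt_or_gt_of_ne hij with h | h
    · exact key i j h
    · exact (key j i h).symm
  have hsub : (⋃ i ∈ Finset.range n, (fun x => x - a i) ⁻¹' K) ⊆ Set.Icc (-S) (T + S) := by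
    refine Set.iUnion₂_subset fun i hi x hx => ?_
    have h1 := Finset.single_le_sum (f := fun i => |a i|) (fun i _ => abs_nonneg _) hi
    have h2 : 0 ≤ x - a i := hx.2.1
    have h3 : x - a i ≤ T := hx.2.2
    have h4 := abs_le.1 h1
    constructor <;> linarith [h4.1, h4.2]
  have hvol := measure_mono (μ := volume) hsub
  rw [measure_biUnion_finset hdisj fun i _ => hKm.preimage (measurable_sub_const _),
    Real.volume_Icc] at hvol
  simp only [sub_eq_add_neg, measure_preimage_add_right, Finset.sum_const, Finset.card_range, nsmul_eq_mul] at hvol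
  have h5 : volume K ≤ ENNReal.ofReal (T + S + - -S) / n := by
    rw [ENNReal.le_div_iff_mul_le (Or.inl (by exact_mod_cast hn0.ne'))
      (Or.inl (ENNReal.natCast_ne_top n)), mul_comm]
    exact hvol
  refine h5.trans ?_
  rw [← ENNReal.ofReal_natCast, ← ENNReal.ofReal_div_of_pos hn0]
  refine ENNReal.ofReal_le_ofReal ?_
  rw [div_le_iff₀ hn0]
  have h6 : 2 < n * c := (div_lt_iff₀ hc).1 hn
  nlinarith

/-- Diagonal argument: keep the part of the n-th sublevel set beyond a time T₀ n after which it
fills at most a fraction 1/(n+1) of [0, T]. The bound n ≤ T₀ n leaves only finitely many n active at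
time T, and the largest dominates the others. -/
theorem exists_density_zero_tendsto (hf : Continuous f) (hneg : ∀ t, f (-t) = f t)
    (hadd : ∀ s t, f (t + s) ≤ 2 * f t + 2 * f s) (hunb : ∀ R, ∃ t, R < f t) :
    ∃ D : Set ℝ, D ⊆ Set.Ici 0 ∧ MeasurableSet D ∧ upperDensity D = 0 ∧
      TendsToInftyOutside f D := by
  let K : ℕ → Set ℝ := fun n => {t | 0 ≤ t ∧ f t ≤ n}
  have hKmono : Monotone K := fun m n hmn t ht =>
    ⟨ht.1, ht.2.trans (Nat.cast_le.2 hmn)⟩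
  have hKm : ∀ n, MeasurableSet (K n) := fun n =>
    (measurableSet_le measurable_const measurable_id).inter
      (measurableSet_le hf.measurable measurable_const)
  have hT : ∀ n : ℕ, ∃ T₀ : ℝ, n ≤ T₀ ∧ ∀ T ≥ T₀,
      volume (K n ∩ Set.Icc 0 T) ≤ ENNReal.ofReal (1 / ((n : ℝ) + 1) * T) := by
    intro n
    obtain ⟨T₀, hT₀⟩ := eventually_atTop.1 (eventually_volume_sublevel_le hf hneg hadd hunb n
      (by positivity : 0 < 1 / ((n : ℝ) + 1)))
    exact ⟨max n T₀, le_max_left _ _, fun T hT => hT₀ T ((le_max_right _ _).trans hT)⟩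
  choose T₀ hnT hT₀ using hT
  refine ⟨⋃ n, K n ∩ Set.Ici (T₀ n), Set.iUnion_subset fun n t ht => ht.1.1,
    MeasurableSet.iUnion fun n => (hKm n).inter measurableSet_Ici, ?_, ?_⟩
  · have hle : ∀ n : ℕ, upperDensity (⋃ n, K n ∩ Set.Ici (T₀ n))
        ≤ ENNReal.ofReal (1 / ((n : ℝ) + 1)) := by
      intro n
      refine upperDensity_le_of_eventually (by positivity) ?_
      filter_upwards [eventually_ge_atTop (T₀ n)] with T hTn
      have hT0 : 0 ≤ T := ((Nat.cast_nonneg n).trans (hnT n)).trans hTn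
      have hceil : ∀ k, T₀ k ≤ T → k ≤ ⌈T⌉₊ := fun k hk =>
        Nat.cast_le.1 (((hnT k).trans hk).trans (Nat.le_ceil T))
      classical
      set m := Nat.findGreatest (fun k => T₀ k ≤ T) ⌈T⌉₊ with hm
      have hnm : n ≤ m := Nat.le_findGreatest (hceil n hTn) hTn
      have hmT : T₀ m ≤ T :=
        Nat.findGreatest_spec (P := fun k => T₀ k ≤ T) (hceil n hTn) hTn
      refine (measure_mono ?_).trans ((hT₀ m T hmT).trans (ENNReal.ofReal_le_ofReal ?_))
      · rintro t ⟨ht, htT⟩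
        obtain ⟨k, hk1, hk2⟩ := Set.mem_iUnion.1 ht
        have hkT : T₀ k ≤ T := le_trans hk2 htT.2
        exact ⟨hKmono (Nat.le_findGreatest (hceil k hkT) hkT) hk1, htT⟩
      · gcongr
    refine le_antisymm (ge_of_tendsto' (x := atTop) ?_ hle) bot_le
    have := ENNReal.tendsto_ofReal (tendsto_one_div_add_atTop_nhds_zero_nat (𝕜 := ℝ))
    simpa using this
  · refine tendsto_atTop.2 fun b => ?_
    obtain ⟨n, hn⟩ := exists_nat_ge b
    rw [eventually_inf_principal]
    filter_upwards [eventually_ge_atTop (T₀ n)] with t ht htD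
    by_contra! hlt
    exact htD (Set.mem_iUnion.2 ⟨n, ⟨((Nat.cast_nonneg n).trans (hnT n)).trans ht,
      hlt.le.trans hn⟩, ht⟩)

/-- If f were bounded, D would contain a half-line, and so have density at least 1/2. -/
lemma unbounded_of_tendsToInftyOutside {D : Set ℝ} (hD : upperDensity D ≤ ENNReal.ofReal (1 / 4))
    (h : TendsToInftyOutside f D) (R : ℝ) : ∃ t, R < f t := by
  by_contra! hR
  have h1 := tendsto_atTop.1 h (R + 1)
  rw [eventually_inf_principal] at h1
  obtain ⟨t₀, ht₀⟩ := eventually_atTop.1 h1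
  have hmem : ∀ t ≥ t₀, t ∈ D := by
    intro t ht
    by_contra htD
    have := ht₀ t ht htD
    linarith [hR t]
  have h2 : ENNReal.ofReal (1 / 2) ≤ upperDensity D := by
    refine upperDensity_ge_of_eventually (by norm_num) ?_
    filter_upwards [eventually_ge_atTop (2 * |t₀|)] with T hT
    calc ENNReal.ofReal (1 / 2 * T) ≤ volume (Set.Icc |t₀| T) := by
          rw [Real.volume_Icc]
          exact ENNReal.ofReal_le_ofReal (by linarith)
      _ ≤ volume (D ∩ Set.Icc 0 T) := measure_mono fun t ht =>
          ⟨hmem t ((le_abs_self _).trans ht.1), (abs_nonneg _).trans ht.1, ht.2⟩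
  have h3 := h2.trans hD
  rw [ENNReal.ofReal_le_ofReal_iff (by norm_num)] at h3
  norm_num at h3

end Density

/-! ### An ergodic-theoretic criterion in L² -/

section Flow

variable {α : Type*} [MeasurableSpace α] {μ : Measure α} [IsProbabilityMeasure μ]
  {T : ℝ → α → α}

open RealInnerProductSpace in
/-- For a measure-preserving flow whose invariant events are trivial, the correlations between the
translates of an event cannot be uniformly positive. -/
theorem exists_measure_inter_preimage_lt (hT : ∀ s, MeasurePreserving (T s) μ μ)
    (hTadd : ∀ s t, T s ∘ T t = T (s + t)) (hT0 : T 0 = id)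
    (htriv : ∀ A, MeasurableSet A → (∀ s, T s ⁻¹' A =ᵐ[μ] A) → μ A = 0 ∨ μ A = 1)
    {A : Set α} (hA : MeasurableSet A) {δ : ℝ} (hδ : 0 < δ) :
    ∃ s, μ.real (T s ⁻¹' A ∩ A) < μ.real A ^ 2 + δ := by
  by_contra! hcor
  have hAs : ∀ s, MeasurableSet (T s ⁻¹' A) := fun s => hA.preimage (hT s).measurable
  let e : ℝ → Lp ℝ 2 μ := fun s => indicatorConstLp 2 (hAs s) (measure_ne_top μ _) (1 : ℝ)
  let one : Lp ℝ 2 μ := indicatorConstLp 2 MeasurableSet.univ (measure_ne_top μ _) (1 : ℝ)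
  let V : ℝ → Lp ℝ 2 μ →ₗᵢ[ℝ] Lp ℝ 2 μ := fun s => Lp.compMeasurePreservingₗᵢ ℝ (T s) (hT s)
  have hVe : ∀ r s, V r (e s) = e (s + r) := by
    intro r s
    have h1 : V r (e s) = indicatorConstLp 2 ((hAs s).preimage (hT r).measurable)
      (measure_ne_top μ _) (1 : ℝ) := rfl
    have h2 : T r ⁻¹' (T s ⁻¹' A) = T (s + r) ⁻¹' A := by rw [← hTadd]; rfl
    rw [h1]
    simp only [e]
    congr 1
  have hVone : ∀ r, V r one = one := fun r => rfl
  -- A closed convex set containing the indicator of A and preserved by the flow's isometries. Its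
  -- element of minimal norm is invariant, hence constant, with value μ(A); testing it against the
  -- indicator gives μ(A)² + δ ≤ μ(A)².
  let K : Set (Lp ℝ 2 μ) := {g | ⟪one, g⟫ = μ.real A} ∩ ⋂ s, {g | μ.real A ^ 2 + δ ≤ ⟪e s, g⟫}
  have hK : IsClosed K := by
    refine (isClosed_eq (by fun_prop) continuous_const).inter (isClosed_iInter fun s => ?_)
    exact isClosed_le continuous_const (by fun_prop)
  have hKc : Convex ℝ K := by
    have hlin : ∀ h : Lp ℝ 2 μ, IsLinearMap ℝ fun g => ⟪h, g⟫ := fun h =>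
      ⟨fun _ _ => inner_add_right _ _ _, fun _ _ => real_inner_smul_right _ _ _⟩
    exact (convex_hyperplane (hlin _) _).inter
      (convex_iInter fun s => convex_halfSpace_ge (hlin _) _)
  have hKne : e 0 ∈ K := by
    refine ⟨?_, Set.mem_iInter.2 fun s => ?_⟩
    · change ⟪one, e 0⟫ = μ.real A
      simp only [one, e]
      rw [L2.real_inner_indicatorConstLp_one_indicatorConstLp_one, Set.univ_inter, hT0,
        Set.preimage_id]
    · change μ.real A ^ 2 + δ ≤ ⟪e s, e 0⟫
      simp only [e]
      rw [L2.real_inner_indicatorConstLp_one_indicatorConstLp_one, hT0, Set.preimage_id]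
      exact hcor s
  have hKV : ∀ r, ∀ g ∈ K, V r g ∈ K := by
    rintro r g ⟨hg1, hg2⟩
    refine ⟨?_, Set.mem_iInter.2 fun s => ?_⟩
    · change ⟪one, V r g⟫ = μ.real A
      rw [← hVone r, LinearIsometry.inner_map_map]
      exact hg1
    · change μ.real A ^ 2 + δ ≤ ⟪e s, V r g⟫
      have : e s = V r (e (s - r)) := by rw [hVe, sub_add_cancel]
      rw [this, LinearIsometry.inner_map_map]
      exact Set.mem_iInter.1 hg2 (s - r)
  obtain ⟨v, hvK, hv⟩ := exists_norm_eq_iInf_of_complete_convex ⟨_, hKne⟩ hK.isComplete hKc 0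
  have hvinv : ∀ r, V r v = v := by
    intro r
    -- The variational inequality gives ‖v‖² ≤ ⟪v, V r v⟫; with ‖V r v‖ = ‖v‖ this forces V r v = v.
    have h1 := (norm_eq_iInf_iff_real_inner_le_zero hKc hvK).1 hv _ (hKV r v hvK)
    rw [zero_sub, inner_neg_left, inner_sub_right, real_inner_self_eq_norm_sq] at h1
    rw [← sub_eq_zero, ← norm_eq_zero, ← sq_eq_zero_iff]
    refine le_antisymm ?_ (sq_nonneg _)
    rw [norm_sub_sq_real, LinearIsometry.norm_map, real_inner_comm]
    linarith
  have hvcomp : ∀ r, v ∘ T r =ᵐ[μ] v := fun r => by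
    have h1 : V r v =ᵐ[μ] v ∘ T r := Lp.coeFn_compMeasurePreserving v (hT r)
    rw [hvinv r] at h1
    exact h1.symm
  have hvm : Measurable v := (Lp.stronglyMeasurable v).measurable
  obtain ⟨c, hc⟩ : ∃ c, v =ᵐ[μ] Function.const α c := by
    refine exists_eventuallyEq_const_of_forall_separating MeasurableSet fun S hS => ?_
    have hinv : ∀ s, T s ⁻¹' (v ⁻¹' S) =ᵐ[μ] v ⁻¹' S := fun s =>
      Filter.eventuallyEq_set.2 ((hvcomp s).mono fun x hx => by
        change v (T s x) ∈ S ↔ v x ∈ S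
        rw [← hx]; rfl)
    rcases htriv (v ⁻¹' S) (hvm hS) hinv with h | h
    · right
      exact measure_eq_zero_iff_ae_notMem.1 h
    · left
      exact (mem_ae_iff_prob_eq_one (hvm hS)).2 h
  have hval : ∀ {B : Set α} (hB : MeasurableSet B),
      ⟪indicatorConstLp 2 hB (measure_ne_top μ _) (1 : ℝ), v⟫ = μ.real B * c := by
    intro B hB
    rw [L2.inner_indicatorConstLp_one, integral_congr_ae (ae_restrict_of_ae hc)]
    simp
  have h1 : μ.real Set.univ * c = μ.real A := (hval MeasurableSet.univ).symm.trans hvK.1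
  have h2 : μ.real A ^ 2 + δ ≤ μ.real (T 0 ⁻¹' A) * c :=
    (Set.mem_iInter.1 hvK.2 0).trans (hval (hAs 0)).le
  rw [probReal_univ, one_mul] at h1
  rw [h1, hT0, Set.preimage_id] at h2
  nlinarith

end Flow

/-! ### Finite-dimensional distributions -/

section FiniteDimensional

/-- The exponent function of the event that a Brown--Resnick process is at most `y i` at time
`t i` for all `i ∈ I`. -/
def scaledMax {ι : Type*} (I : Finset ι) (t : ι → ℝ) (y : ι → ℝ) (x : ℝ → ℝ) : ℝ≥0∞ :=
  I.sup fun i => ENNReal.ofReal (Real.exp (x (t i))) / ENNReal.ofReal (y i)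

variable {ι : Type*} {I : Finset ι} {t y : ι → ℝ}

lemma measurable_scaledMax : Measurable (scaledMax I t y) := by
  classical
  unfold scaledMax
  induction I using Finset.induction_on with
  | empty => simp only [Finset.sup_empty]; exact measurable_const
  | insert a s ha ih =>
    simp only [Finset.sup_insert]
    exact Measurable.sup (by fun_prop) ih

lemma scaledMax_add_const (x : ℝ → ℝ) (c : ℝ) :
    scaledMax I t y (fun s => x s + c) = ENNReal.ofReal (Real.exp c) * scaledMax I t y x := by
  unfold scaledMax
  rw [Finset.apply_sup_eq_sup_comp (fun z => ENNReal.ofReal (Real.exp c) * z)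
    (fun a b => (mul_right_mono (a := ENNReal.ofReal (Real.exp c))).map_sup a b) (mul_zero _)]
  refine Finset.sup_congr rfl fun i _ => ?_
  rw [Function.comp_apply, Real.exp_add, mul_comm (Real.exp _), ENNReal.ofReal_mul
    (Real.exp_pos _).le, mul_div_assoc]

/-- For b ≤ 0 the quotient is ∞, so nonpositive levels correctly receive an infinite exponent. -/
lemma ofReal_div_ofReal_le_one {a b : ℝ} (ha : 0 < a) :
    ENNReal.ofReal a / ENNReal.ofReal b ≤ 1 ↔ a ≤ b := by
  rcases le_or_gt b 0 with hb | hb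
  · rw [ENNReal.ofReal_of_nonpos hb, ENNReal.div_zero (ENNReal.ofReal_pos.2 ha).ne']
    simp only [top_le_iff, ENNReal.one_ne_top, false_iff]
    linarith
  · rw [ENNReal.div_le_iff_le_mul (Or.inl (ENNReal.ofReal_pos.2 hb).ne')
      (Or.inl ENNReal.ofReal_ne_top), one_mul, ENNReal.ofReal_le_ofReal_iff hb.le]

lemma exp_mul_scaledMax_le_one (u : ℝ) (x : ℝ → ℝ) :
    ENNReal.ofReal (Real.exp u) * scaledMax I t y x ≤ 1
      ↔ ∀ i ∈ I, Real.exp (u + x (t i)) ≤ y i := by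
  rw [← scaledMax_add_const]
  unfold scaledMax
  rw [Finset.sup_le_iff]
  refine forall₂_congr fun i _ => ?_
  rw [ofReal_div_ofReal_le_one (Real.exp_pos _), add_comm]

variable {Ω Ω₀ : Type*} [MeasurableSpace Ω] [MeasurableSpace Ω₀]
  {P : Measure Ω} {P₀ : Measure Ω₀}
  {W₀ : ℝ → Ω₀ → ℝ} {σ2 : ℝ → ℝ} {U : ℕ → Ω → ℝ} {W : ℕ → ℝ → Ω → ℝ}

lemma IsGaussianStatIncr.lintegral_exp [IsProbabilityMeasure P₀] (hW₀ : IsGaussianStatIncr W₀ P₀) (t : ℝ) :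
    ∫⁻ ω, ENNReal.ofReal (Real.exp (W₀ t ω - Var[W₀ t; P₀] / 2)) ∂P₀ = 1 := by
  have := lintegral_exp_mul_gaussianProcess hW₀.gaussian hW₀.measurable hW₀.mean_zero t
    (F := fun _ => 1) measurable_const
  simpa using this

namespace IsBrownResnickInput

lemma measurable_path (h : IsBrownResnickInput U W P W₀ P₀) (i : ℕ) :
    Measurable fun ω t => W i t ω :=
  measurable_pi_lambda _ (h.measurable_W i)

lemma measurable_brTerm (h : IsBrownResnickInput U W P W₀ P₀) (t : ℝ) (i : ℕ) :
    Measurable fun ω => brTerm σ2 U W t ω i :=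
  Real.measurable_exp.comp (((h.poisson.measurable i).add (h.measurable_W i t)).sub
    measurable_const)

lemma measurable_iSup_brTerm (h : IsBrownResnickInput U W P W₀ P₀) (t : ℝ) :
    Measurable (brProcess σ2 U W t) :=
  Measurable.iSup fun i => h.measurable_brTerm t i

lemma measurable_brPath (h : IsBrownResnickInput U W P W₀ P₀) :
    Measurable fun ω t => brProcess σ2 U W t ω :=
  measurable_pi_lambda _ h.measurable_iSup_brTerm

variable [IsProbabilityMeasure P] [IsProbabilityMeasure P₀]

/-- The maximum defining the Brown--Resnick process is almost surely attained. -/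
theorem ae_isGreatest (h : IsBrownResnickInput U W P W₀ P₀) (hW₀ : IsGaussianStatIncr W₀ P₀)
    (hσ2 : ∀ t, σ2 t = Var[W₀ t; P₀]) (t : ℝ) :
    ∀ᵐ ω ∂P, IsGreatest (Set.range (brTerm σ2 U W t ω)) (brProcess σ2 U W t ω) := by
  have := Measure.isProbabilityMeasure_map (μ := P₀) hW₀.measurable_path.aemeasurable
  -- Only finitely many terms exceed 1/n, as the normalised marks have mean 1. A level 1/n below the
  -- term of index 0 leaves a finite nonempty set, which contains the maximum.
  have hfin : ∀ n : ℕ, ∀ᵐ ω ∂P, {i | 1 < ENNReal.ofReal (Real.exp (U i ω)) *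
      (ENNReal.ofReal (Real.exp (W i t ω - σ2 t / 2)) * n)}.Finite := by
    intro n
    have hVm : Measurable fun x : ℝ → ℝ => ENNReal.ofReal (Real.exp (x t - σ2 t / 2)) * n := by
      fun_prop
    refine ae_finite_exp_mul_gt_one (Y := fun i ω t => W i t ω)
      (ν := P₀.map fun ω t => W₀ t ω) h.poisson h.measurable_path
      (fun i => (h.copies i).map_eq) (fun i => ?_) hVm ?_
    · exact h.indep_U_W.comp (measurable_pi_apply i) (measurable_pi_apply i)
    · rw [lintegral_map hVm hW₀.measurable_path, lintegral_mul_const _ (by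
        exact ((hW₀.measurable t).sub measurable_const).exp.ennreal_ofReal), hσ2,
        hW₀.lintegral_exp, one_mul]
      exact ENNReal.natCast_ne_top n
  filter_upwards [ae_all_iff.2 hfin] with ω hω
  have hiff : ∀ (n : ℕ) i, 1 < ENNReal.ofReal (Real.exp (U i ω)) *
      (ENNReal.ofReal (Real.exp (W i t ω - σ2 t / 2)) * n) ↔ 1 < brTerm σ2 U W t ω i * n := by
    intro n i
    rw [← mul_assoc, ← ENNReal.ofReal_mul (Real.exp_pos _).le, ← Real.exp_add,
      ← ENNReal.ofReal_natCast, ← ENNReal.ofReal_mul (Real.exp_pos _).le, ENNReal.one_lt_ofReal,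
      brTerm, add_sub_assoc]
  have hpos : 0 < brTerm σ2 U W t ω 0 := Real.exp_pos _
  obtain ⟨n, hn⟩ := exists_nat_gt (brTerm σ2 U W t ω 0)⁻¹
  have hn0 : (0 : ℝ) < n := (inv_pos.2 hpos).trans hn
  have h0 : 1 < brTerm σ2 U W t ω 0 * n := by
    rwa [inv_lt_iff_one_lt_mul₀' hpos] at hn
  have hne : {i | 1 < brTerm σ2 U W t ω i * n}.Nonempty := ⟨0, h0⟩
  have hF : {i | 1 < brTerm σ2 U W t ω i * n}.Finite := by
    refine (hω n).subset fun i hi => (hiff n i).2 hi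
  obtain ⟨m, hm, hmax⟩ := hF.exists_maximalFor (brTerm σ2 U W t ω) _ hne
  have hG : IsGreatest (Set.range (brTerm σ2 U W t ω)) (brTerm σ2 U W t ω m) := by
    refine ⟨⟨m, rfl⟩, ?_⟩
    rintro _ ⟨i, rfl⟩
    rcases le_total (brTerm σ2 U W t ω i) (brTerm σ2 U W t ω m) with hle | hle
    · exact hle
    · refine hmax (?_ : 1 < brTerm σ2 U W t ω i * n) hle
      exact lt_of_lt_of_le hm (mul_le_mul_of_nonneg_right hle hn0.le)
  rw [brProcess, iSup, hG.csSup_eq]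
  exact hG

/-- The finite-dimensional distributions of the Brown--Resnick process. -/
theorem measure_forall_le (h : IsBrownResnickInput U W P W₀ P₀)
    (hW₀ : IsGaussianStatIncr W₀ P₀) (hσ2 : ∀ t, σ2 t = Var[W₀ t; P₀])
    (I : Finset ι) (t y : ι → ℝ) :
    P {ω | ∀ i ∈ I, brProcess σ2 U W (t i) ω ≤ y i}
      = expNeg (∫⁻ ω, scaledMax I t y (fun s => W₀ s ω - σ2 s / 2) ∂P₀) := by
  have := Measure.isProbabilityMeasure_map (μ := P₀) hW₀.measurable_path.aemeasurable
  have hVm : Measurable fun x : ℝ → ℝ => scaledMax I t y (fun s => x s - σ2 s / 2) :=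
    measurable_scaledMax.comp (measurable_pi_lambda _ fun s => by fun_prop)
  have hvoid := measure_forall_exp_mul_le_one (Y := fun i ω t => W i t ω)
      (ν := P₀.map fun ω t => W₀ t ω) h.poisson h.measurable_path
      (fun i => (h.copies i).map_eq) h.indep_W h.indep_U_W hVm
  rw [lintegral_map hVm hW₀.measurable_path] at hvoid
  rw [← hvoid]
  refine measure_congr (Filter.eventuallyEq_set.2 ?_)
  -- A real supremum of an unbounded family is 0 by convention; attainment makes "supremum ≤ y"
  -- equivalent to "all terms ≤ y".
  filter_upwards [(ae_ball_iff I.countable_toSet).2 fun i (_ : i ∈ (I : Set ι)) =>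
    h.ae_isGreatest hW₀ hσ2 (t i)] with ω hω
  simp only [exp_mul_scaledMax_le_one]
  constructor
  · intro hle k i hi
    refine le_trans (le_of_eq ?_) (((hω i hi).2 ⟨k, rfl⟩).trans (hle i hi))
    rw [brTerm, add_sub_assoc]
  · intro hle i hi
    obtain ⟨k, hk⟩ := (hω i hi).1
    rw [← hk, brTerm, add_sub_assoc]
    exact hle k i hi

end IsBrownResnickInput

end FiniteDimensional

/-! ### Orthants, and mixing along a sequence -/

section PathSpace

/-- The set of paths that are at most `y j` at each time `j ∈ J`. -/
def orthant (J : Finset ℝ) (y : ℝ → ℝ) : Set (ℝ → ℝ) := {x | ∀ j ∈ J, x j ≤ y j}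

/-- The family of all orthants. -/
def orthants : Set (Set (ℝ → ℝ)) := {A | ∃ J y, A = orthant J y}

lemma measurableSet_orthant (J : Finset ℝ) (y : ℝ → ℝ) : MeasurableSet (orthant J y) := by
  have : orthant J y = ⋂ j ∈ J, (fun x : ℝ → ℝ => x j) ⁻¹' Set.Iic (y j) := by
    ext; simp [orthant]
  rw [this]
  exact J.measurableSet_biInter fun j _ => measurable_pi_apply j measurableSet_Iic

lemma isPiSystem_orthants : IsPiSystem orthants := by
  classical
  rintro _ ⟨J, y, rfl⟩ _ ⟨K, z, rfl⟩ -
  refine ⟨J ∪ K, fun j => if j ∈ J then (if j ∈ K then min (y j) (z j) else y j) else z j, ?_⟩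
  ext x
  simp only [orthant, Set.mem_inter_iff, Set.mem_ofPred_eq, Finset.mem_union]
  constructor
  · rintro ⟨h1, h2⟩ j hj
    split_ifs with hJ hK
    · exact le_min (h1 j hJ) (h2 j hK)
    · exact h1 j hJ
    · exact h2 j (hj.resolve_left hJ)
  · intro h
    refine ⟨fun j hj => ?_, fun j hj => ?_⟩
    · have := h j (Or.inl hj)
      rw [if_pos hj] at this
      split_ifs at this with hK
      · exact this.trans (min_le_left _ _)
      · exact this
    · have := h j (Or.inr hj)
      rw [if_pos hj] at this
      split_ifs at this with hJ
      · exact this.trans (min_le_right _ _)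
      · exact this

lemma generateFrom_orthants :
    (MeasurableSpace.pi : MeasurableSpace (ℝ → ℝ)) = MeasurableSpace.generateFrom orthants := by
  refine le_antisymm ?_ (MeasurableSpace.generateFrom_le ?_)
  · refine iSup_le fun t => measurable_iff_comap_le.1 ?_
    let : MeasurableSpace (ℝ → ℝ) := MeasurableSpace.generateFrom orthants
    refine measurable_of_Iic fun a => ?_
    refine MeasurableSpace.measurableSet_generateFrom ⟨{t}, fun _ => a, ?_⟩
    ext; simp [orthant]
  · rintro _ ⟨J, y, rfl⟩
    exact measurableSet_orthant J y

lemma measurable_shift (s : ℝ) : Measurable (shift s) :=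
  measurable_pi_lambda _ fun t => measurable_pi_apply (t + s)

lemma shift_comp_shift (s t : ℝ) : shift s ∘ shift t = shift (s + t) := by
  ext x u
  simp [shift, add_assoc]

lemma shift_zero : shift 0 = id := by
  ext x u
  simp [shift]

variable {μ : Measure (ℝ → ℝ)} [IsProbabilityMeasure μ]

/-- Asymptotic independence from the orthants extends to all events. -/
lemma tendsto_measure_inter_of_orthants {C : ℕ → Set (ℝ → ℝ)} (hC : ∀ n, MeasurableSet (C n))
    {b : ℝ} (hCb : ∀ n, μ.real (C n) = b)
    (h : ∀ A ∈ orthants, Tendsto (fun n => μ.real (A ∩ C n)) atTop (𝓝 (μ.real A * b)))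
    {A : Set (ℝ → ℝ)} (hA : MeasurableSet A) :
    Tendsto (fun n => μ.real (A ∩ C n)) atTop (𝓝 (μ.real A * b)) := by
  induction A, hA using MeasurableSpace.induction_on_inter generateFrom_orthants
    isPiSystem_orthants with
  | empty => simp
  | basic A hA => exact h A hA
  | compl A hA ih =>
    have h1 : ∀ n, μ.real (Aᶜ ∩ C n) = b - μ.real (A ∩ C n) := fun n => by
      rw [← hCb n, ← measureReal_inter_add_sdiff hA (s := C n), Set.inter_comm A,
        Set.inter_comm Aᶜ, add_sub_cancel_left]
      rfl
    simp_rw [h1, probReal_compl_eq_one_sub hA, sub_mul, one_mul]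
    exact tendsto_const_nhds.sub ih
  | iUnion f hdisj hf ih =>
    have hsum : ∀ {D : Set (ℝ → ℝ)}, MeasurableSet D →
        HasSum (fun i => μ.real (f i ∩ D)) (μ.real ((⋃ i, f i) ∩ D)) := by
      intro D hD
      rw [Set.iUnion_inter]
      have e := measure_iUnion (μ := μ) (f := fun i => f i ∩ D)
        (fun i j hij => (hdisj hij).mono Set.inter_subset_left Set.inter_subset_left)
        fun i => (hf i).inter hD
      rw [measureReal_def, e, ENNReal.tsum_toReal_eq fun i => measure_ne_top _ _]
      exact ENNReal.hasSum_toReal (by rw [← e]; exact measure_ne_top _ _)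
    have hs : HasSum (fun i => μ.real (f i)) (μ.real (⋃ i, f i)) := by
      simpa using hsum MeasurableSet.univ
    simp_rw [← (hsum (hC _)).tsum_eq]
    rw [← (hs.mul_right b).tsum_eq]
    refine tendsto_tsum_of_dominated_convergence hs.summable ih (Eventually.of_forall fun n i => ?_)
    rw [Real.norm_of_nonneg measureReal_nonneg]
    exact measureReal_mono Set.inter_subset_left

/-- Mixing of orthants along a sequence of translations implies ergodicity. -/
theorem measure_eq_zero_or_one_of_tendsto {s : ℕ → ℝ}
    (hμ : ∀ s, MeasurePreserving (shift s) μ μ)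
    (hmix : ∀ A ∈ orthants, ∀ B ∈ orthants,
      Tendsto (fun n => μ.real (A ∩ shift (s n) ⁻¹' B)) atTop (𝓝 (μ.real A * μ.real B)))
    {A : Set (ℝ → ℝ)} (hA : MeasurableSet A) (hinv : ∀ s, shift s ⁻¹' A =ᵐ[μ] A) :
    μ A = 0 ∨ μ A = 1 := by
  have hreal : ∀ (r : ℝ) {D : Set (ℝ → ℝ)}, MeasurableSet D →
      μ.real (shift r ⁻¹' D) = μ.real D := fun r D hD => by
    rw [measureReal_def, (hμ r).measure_preimage hD.nullMeasurableSet, measureReal_def]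
  -- Extend mixing from orthants to the invariant event A in the first slot only. Invariance makes
  -- the sequence constant in n, so its limit gives independence of A and B.
  have horth : ∀ B ∈ orthants, μ.real (A ∩ B) = μ.real A * μ.real B := by
    intro B hB
    have hBm : MeasurableSet B := by
      obtain ⟨J, y, rfl⟩ := hB
      exact measurableSet_orthant J y
    have h1 := tendsto_measure_inter_of_orthants (C := fun n => shift (s n) ⁻¹' B)
      (fun n => measurable_shift _ hBm) (fun n => hreal (s n) hBm) (fun A' hA' => hmix A' hA' B hB)
      hA
    refine tendsto_nhds_unique ?_ h1
    have h2 : ∀ n, μ.real (A ∩ shift (s n) ⁻¹' B) = μ.real (A ∩ B) := fun n => by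
      rw [← hreal (s n) (hA.inter hBm), Set.preimage_inter]
      exact measureReal_congr ((hinv (s n)).symm.inter (ae_eq_refl _))
    simp_rw [h2]
    exact tendsto_const_nhds
  -- A is independent of a generating π-system, hence of every event, itself included.
  have hext : μ.restrict A = μ A • μ := by
    refine ext_of_generate_finite orthants generateFrom_orthants isPiSystem_orthants ?_ ?_
    · intro B hB
      have hBm : MeasurableSet B := by
        obtain ⟨J, y, rfl⟩ := hB
        exact measurableSet_orthant J y
      have h1 := horth B hB
      rw [measureReal_def, measureReal_def, measureReal_def, ← ENNReal.toReal_mul,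
        ENNReal.toReal_eq_toReal_iff' (by finiteness) (by finiteness)] at h1
      rw [Measure.restrict_apply hBm, Set.inter_comm, h1]
      rfl
    · simp
  have h2 : μ A = μ A * μ A := by
    have := congrArg (fun ν => ν A) hext
    simpa [Measure.restrict_apply hA] using this
  rcases eq_or_ne (μ A) 0 with h | h
  · exact Or.inl h
  · right
    have h3 : μ A * 1 = μ A * μ A := by rw [mul_one]; exact h2
    exact ((ENNReal.mul_right_inj h (measure_ne_top _ _)).1 h3).symm

end PathSpace

/-! ### Stationarity, and ergodicity versus unbounded variance -/

section ErgodicityCriterion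

variable {Ω Ω₀ : Type*} [MeasurableSpace Ω] [MeasurableSpace Ω₀]
  {P : Measure Ω} [IsProbabilityMeasure P] {P₀ : Measure Ω₀}
  {W₀ : ℝ → Ω₀ → ℝ} {σ2 : ℝ → ℝ} {U : ℕ → Ω → ℝ} {W : ℕ → ℝ → Ω → ℝ}

lemma IsBrownResnickInput.isProbabilityMeasure_pathLaw (h : IsBrownResnickInput U W P W₀ P₀) :
    IsProbabilityMeasure (pathLaw (brProcess σ2 U W) P) :=
  Measure.isProbabilityMeasure_map h.measurable_brPath.aemeasurable

variable [IsProbabilityMeasure P₀]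

lemma IsGaussianStatIncr.lintegral_shift_normalised (hW₀ : IsGaussianStatIncr W₀ P₀)
    (hσ2 : ∀ t, σ2 t = Var[W₀ t; P₀]) (s : ℝ) {G : (ℝ → ℝ) → ℝ≥0∞} (hG : Measurable G)
    (hhom : ∀ x c, G (fun t => x t + c) = ENNReal.ofReal (Real.exp c) * G x) :
    ∫⁻ ω, G (fun t => W₀ (t + s) ω - σ2 (t + s) / 2) ∂P₀
      = ∫⁻ ω, G (fun t => W₀ t ω - σ2 t / 2) ∂P₀ := by
  simp_rw [hσ2]
  exact hW₀.lintegral_shift_eq s hG hhom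

/-- The expected minimum of two values of the normalised log-Gaussian process. -/
lemma IsGaussianStatIncr.lintegral_min_eq (hW₀ : IsGaussianStatIncr W₀ P₀)
    (hσ2 : ∀ t, σ2 t = Var[W₀ t; P₀]) (a b : ℝ) :
    ∫⁻ ω, min (ENNReal.ofReal (Real.exp (W₀ a ω - σ2 a / 2)))
        (ENNReal.ofReal (Real.exp (W₀ b ω - σ2 b / 2))) ∂P₀
      = ∫⁻ ω, min 1 (ENNReal.ofReal (Real.exp (W₀ (b - a) ω - σ2 (b - a) / 2))) ∂P₀ := by
  have h := hW₀.lintegral_shift_normalised hσ2 a (G := fun x =>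
    min (ENNReal.ofReal (Real.exp (x 0))) (ENNReal.ofReal (Real.exp (x (b - a)))))
    (by fun_prop) (fun x c => by
      rw [(mul_right_mono (a := ENNReal.ofReal (Real.exp c))).map_min]
      simp_rw [← ENNReal.ofReal_mul (Real.exp_pos c).le, ← Real.exp_add, add_comm c])
  simp only [zero_add, sub_add_cancel] at h
  rw [h]
  refine lintegral_congr_ae ?_
  filter_upwards [hW₀.zero_at_zero] with ω hω
  simp [hω, hσ2, hW₀.variance_zero]

/-- Use min(1, z) ≤ √z and the Gaussian moment generating function at 1/2: the exponents -σ²/4 and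
σ²/8 add to -σ²/8. -/
lemma IsGaussianStatIncr.lintegral_min_le (hW₀ : IsGaussianStatIncr W₀ P₀)
    (hσ2 : ∀ t, σ2 t = Var[W₀ t; P₀]) (a b : ℝ) :
    ∫⁻ ω, min (ENNReal.ofReal (Real.exp (W₀ a ω - σ2 a / 2)))
        (ENNReal.ofReal (Real.exp (W₀ b ω - σ2 b / 2))) ∂P₀
      ≤ ENNReal.ofReal (Real.exp (-(σ2 (b - a) / 8))) := by
  rw [hW₀.lintegral_min_eq hσ2]
  set c := b - a
  have h1 : ∀ ω, min 1 (ENNReal.ofReal (Real.exp (W₀ c ω - σ2 c / 2)))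
      ≤ ENNReal.ofReal (Real.exp (-(σ2 c / 4))) * ENNReal.ofReal (Real.exp (1 / 2 * W₀ c ω)) := by
    intro ω
    rw [← ENNReal.ofReal_mul (Real.exp_pos _).le, ← Real.exp_add]
    rcases le_total 0 (W₀ c ω - σ2 c / 2) with h | h
    · refine (min_le_left _ _).trans ?_
      rw [ENNReal.one_le_ofReal, Real.one_le_exp_iff]
      linarith
    · refine (min_le_right _ _).trans (ENNReal.ofReal_le_ofReal (Real.exp_le_exp.2 ?_))
      linarith
  have h2 : ∫⁻ ω, ENNReal.ofReal (Real.exp (1 / 2 * W₀ c ω)) ∂P₀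
      = ENNReal.ofReal (Real.exp (σ2 c / 8)) := by
    rw [← lintegral_map (f := fun x => ENNReal.ofReal (Real.exp (1 / 2 * x))) (by fun_prop)
      (hW₀.measurable c), hW₀.map_eq, ← ofReal_integral_eq_lintegral_ofReal
      (integrable_exp_mul_gaussianReal _) (ae_of_all _ fun _ => (Real.exp_pos _).le)]
    have := congrFun (mgf_fun_id_gaussianReal (μ := 0) (v := Var[W₀ c; P₀].toNNReal)) (1 / 2)
    rw [mgf] at this
    rw [this, Real.coe_toNNReal _ (variance_nonneg _ _), hσ2]
    congr 2
    ring
  refine (lintegral_mono h1).trans (le_of_eq ?_)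
  rw [lintegral_const_mul _ ((hW₀.measurable c).const_mul _).exp.ennreal_ofReal, h2,
    ← ENNReal.ofReal_mul (Real.exp_pos _).le, ← Real.exp_add]
  congr 2
  ring

/-- By symmetry W ≥ 0 with probability at least 1/2, and there the minimum is at least e^{-R/2}. -/
lemma IsGaussianStatIncr.le_lintegral_min (hW₀ : IsGaussianStatIncr W₀ P₀)
    (hσ2 : ∀ t, σ2 t = Var[W₀ t; P₀]) {R : ℝ} (hR : ∀ t, σ2 t ≤ R) (a b : ℝ) :
    ENNReal.ofReal (Real.exp (-(R / 2)) / 2)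
      ≤ ∫⁻ ω, min (ENNReal.ofReal (Real.exp (W₀ a ω - σ2 a / 2)))
        (ENNReal.ofReal (Real.exp (W₀ b ω - σ2 b / 2))) ∂P₀ := by
  rw [hW₀.lintegral_min_eq hσ2]
  set c := b - a
  have hR0 : 0 ≤ R := by
    have h1 := hR 0
    rwa [hσ2, hW₀.variance_zero] at h1
  have hS : MeasurableSet {ω | 0 ≤ W₀ c ω} := measurableSet_le measurable_const (hW₀.measurable c)
  have hhalf : 1 ≤ 2 * P₀ {ω | 0 ≤ W₀ c ω} := by
    have h1 : P₀ {ω | 0 ≤ W₀ c ω} = P₀.map (W₀ c) (Set.Ici 0) := by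
      rw [Measure.map_apply (hW₀.measurable c) measurableSet_Ici]; rfl
    have h2 : P₀.map (W₀ c) (Set.Iic 0) = P₀.map (W₀ c) (Set.Ici 0) := by
      rw [hW₀.map_eq]
      conv_lhs => rw [← neg_zero, ← gaussianReal_map_neg,
        Measure.map_apply measurable_neg measurableSet_Iic]
      congr 1
      ext x
      simp
    have := Measure.isProbabilityMeasure_map (μ := P₀) (hW₀.measurable c).aemeasurable
    rw [two_mul, h1]
    nth_rewrite 1 [← h2]
    calc (1 : ℝ≥0∞) = P₀.map (W₀ c) (Set.Iic 0 ∪ Set.Ici 0) := by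
          rw [Set.Iic_union_Ici, measure_univ]
      _ ≤ _ := measure_union_le _ _
  have h1 : ∀ ω, {ω | 0 ≤ W₀ c ω}.indicator (fun _ => ENNReal.ofReal (Real.exp (-(R / 2)))) ω
      ≤ min 1 (ENNReal.ofReal (Real.exp (W₀ c ω - σ2 c / 2))) := by
    intro ω
    refine Set.indicator_apply_le' (fun hω => le_min ?_ ?_) (fun _ => bot_le)
    · rw [ENNReal.ofReal_le_one, Real.exp_le_one_iff]
      linarith
    · refine ENNReal.ofReal_le_ofReal (Real.exp_le_exp.2 ?_)
      have h2 : 0 ≤ W₀ c ω := hω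
      linarith [hR c]
  refine le_trans ?_ (lintegral_mono h1)
  rw [lintegral_indicator_const hS, ENNReal.ofReal_div_of_pos two_pos]
  refine ENNReal.div_le_of_le_mul ?_
  rw [mul_assoc, mul_comm _ (ENNReal.ofReal 2)]
  calc ENNReal.ofReal (Real.exp (-(R / 2)))
      = ENNReal.ofReal (Real.exp (-(R / 2))) * 1 := (mul_one _).symm
    _ ≤ _ := by
        gcongr
        simpa using hhalf

namespace IsBrownResnickInput

/-- The disjoint union of J and K keeps the two families of levels apart even when times coincide;
the supremum over it splits as a maximum. -/
lemma pathLaw_inter_shift (h : IsBrownResnickInput U W P W₀ P₀)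
    (hW₀ : IsGaussianStatIncr W₀ P₀) (hσ2 : ∀ t, σ2 t = Var[W₀ t; P₀])
    (J K : Finset ℝ) (y z : ℝ → ℝ) (s : ℝ) :
    pathLaw (brProcess σ2 U W) P (orthant J y ∩ shift s ⁻¹' orthant K z)
      = expNeg (∫⁻ ω, max (scaledMax J id y fun t => W₀ t ω - σ2 t / 2)
        (scaledMax K id z fun t => W₀ (t + s) ω - σ2 (t + s) / 2) ∂P₀) := by
  rw [pathLaw, Measure.map_apply h.measurable_brPath ((measurableSet_orthant J y).inter
    (measurable_shift s (measurableSet_orthant K z)))]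
  have h1 := h.measure_forall_le hW₀ hσ2 (J.disjSum K) (Sum.elim id (· + s)) (Sum.elim y z)
  simp only [scaledMax, Finset.sup_disjSum, Sum.elim_inl, Sum.elim_inr] at h1
  simp only [scaledMax]
  refine Eq.trans ?_ h1
  congr 1
  ext ω
  simp [orthant, shift, Finset.mem_disjSum, or_imp, forall_and]

lemma pathLaw_shift_orthant (h : IsBrownResnickInput U W P W₀ P₀)
    (hW₀ : IsGaussianStatIncr W₀ P₀) (hσ2 : ∀ t, σ2 t = Var[W₀ t; P₀])
    (K : Finset ℝ) (z : ℝ → ℝ) (s : ℝ) :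
    pathLaw (brProcess σ2 U W) P (shift s ⁻¹' orthant K z)
      = expNeg (∫⁻ ω, scaledMax K id z (fun t => W₀ t ω - σ2 t / 2) ∂P₀) := by
  have h1 := h.pathLaw_inter_shift hW₀ hσ2 ∅ K z z s
  have h2 : orthant ∅ z = Set.univ := by ext; simp [orthant]
  have h3 : ∀ x : ℝ≥0∞, max 0 x = x := fun x => max_eq_right bot_le
  rw [h2, Set.univ_inter] at h1
  rw [h1, ← hW₀.lintegral_shift_normalised hσ2 s measurable_scaledMax scaledMax_add_const]
  simp [scaledMax]

lemma pathLaw_orthant (h : IsBrownResnickInput U W P W₀ P₀)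
    (hW₀ : IsGaussianStatIncr W₀ P₀) (hσ2 : ∀ t, σ2 t = Var[W₀ t; P₀])
    (K : Finset ℝ) (z : ℝ → ℝ) :
    pathLaw (brProcess σ2 U W) P (orthant K z)
      = expNeg (∫⁻ ω, scaledMax K id z (fun t => W₀ t ω - σ2 t / 2) ∂P₀) := by
  rw [← h.pathLaw_shift_orthant hW₀ hσ2 K z 0, shift_zero, Set.preimage_id]

/-- The Brown--Resnick process is stationary. -/
theorem measurePreserving_shift (h : IsBrownResnickInput U W P W₀ P₀)
    (hW₀ : IsGaussianStatIncr W₀ P₀) (hσ2 : ∀ t, σ2 t = Var[W₀ t; P₀]) (s : ℝ) :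
    MeasurePreserving (shift s) (pathLaw (brProcess σ2 U W) P)
      (pathLaw (brProcess σ2 U W) P) := by
  have := h.isProbabilityMeasure_pathLaw (σ2 := σ2)
  refine ⟨measurable_shift s, ?_⟩
  have := Measure.isProbabilityMeasure_map (μ := pathLaw (brProcess σ2 U W) P)
    (measurable_shift s).aemeasurable
  refine ext_of_generate_finite orthants generateFrom_orthants isPiSystem_orthants ?_ (by simp)
  rintro _ ⟨K, z, rfl⟩
  rw [Measure.map_apply (measurable_shift s) (measurableSet_orthant K z),
    h.pathLaw_shift_orthant hW₀ hσ2, h.pathLaw_orthant hW₀ hσ2]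

lemma pos_of_pathLaw_orthant_ne_zero (h : IsBrownResnickInput U W P W₀ P₀)
    (hW₀ : IsGaussianStatIncr W₀ P₀) (hσ2 : ∀ t, σ2 t = Var[W₀ t; P₀])
    {K : Finset ℝ} {z : ℝ → ℝ} (h0 : pathLaw (brProcess σ2 U W) P (orthant K z) ≠ 0) :
    (∀ k ∈ K, 0 < z k) ∧ ∫⁻ ω, scaledMax K id z (fun t => W₀ t ω - σ2 t / 2) ∂P₀ ≠ ∞ := by
  rw [h.pathLaw_orthant hW₀ hσ2] at h0
  have hfin : ∫⁻ ω, scaledMax K id z (fun t => W₀ t ω - σ2 t / 2) ∂P₀ ≠ ∞ := by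
    intro htop
    rw [htop, expNeg_top] at h0
    exact h0 rfl
  refine ⟨fun k hk => ?_, hfin⟩
  by_contra! hz
  refine hfin ?_
  have h1 : ∀ ω, scaledMax K id z (fun t => W₀ t ω - σ2 t / 2) = ∞ := by
    intro ω
    refine top_le_iff.1 (le_trans ?_ (Finset.le_sup hk))
    rw [ENNReal.ofReal_of_nonpos hz, ENNReal.div_zero (ENNReal.ofReal_pos.2 (Real.exp_pos _)).ne']
  simp [h1]

end IsBrownResnickInput

/-- Both maxima are attained, so the minimum is controlled by one pair (j, k); summing over pairs
removes the dependence on the path. -/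
lemma min_scaledMax_le {J K : Finset ℝ} {t t' y z : ℝ → ℝ} (x : ℝ → ℝ) :
    min (scaledMax J t y x) (scaledMax K t' z x) ≤ ∑ j ∈ J, ∑ k ∈ K,
      max (ENNReal.ofReal (y j))⁻¹ (ENNReal.ofReal (z k))⁻¹ *
        min (ENNReal.ofReal (Real.exp (x (t j)))) (ENNReal.ofReal (Real.exp (x (t' k)))) := by
  rcases J.eq_empty_or_nonempty with rfl | hJ
  · simp [scaledMax]
  rcases K.eq_empty_or_nonempty with rfl | hK
  · simp [scaledMax]
  obtain ⟨j, hj, hj'⟩ := Finset.exists_mem_eq_sup J hJ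
    fun j => ENNReal.ofReal (Real.exp (x (t j))) / ENNReal.ofReal (y j)
  obtain ⟨k, hk, hk'⟩ := Finset.exists_mem_eq_sup K hK
    fun k => ENNReal.ofReal (Real.exp (x (t' k))) / ENNReal.ofReal (z k)
  rw [scaledMax, scaledMax, hj', hk']
  refine le_trans ?_ (Finset.single_le_sum (f := fun j => ∑ k ∈ K,
      max (ENNReal.ofReal (y j))⁻¹ (ENNReal.ofReal (z k))⁻¹ *
        min (ENNReal.ofReal (Real.exp (x (t j)))) (ENNReal.ofReal (Real.exp (x (t' k)))))
    (fun _ _ => bot_le) hj)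
  refine le_trans ?_ (Finset.single_le_sum (f := fun k =>
      max (ENNReal.ofReal (y j))⁻¹ (ENNReal.ofReal (z k))⁻¹ *
        min (ENNReal.ofReal (Real.exp (x (t j)))) (ENNReal.ofReal (Real.exp (x (t' k)))))
    (fun _ _ => bot_le) hk)
  rw [mul_right_mono.map_min, div_eq_mul_inv, div_eq_mul_inv, mul_comm _ (_)⁻¹,
    mul_comm _ (ENNReal.ofReal (z k))⁻¹]
  exact min_le_min (mul_left_mono (le_max_left _ _)) (mul_left_mono (le_max_right _ _))

lemma IsGaussianStatIncr.tendsto_lintegral_min_scaledMax (hW₀ : IsGaussianStatIncr W₀ P₀)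
    (hσ2 : ∀ t, σ2 t = Var[W₀ t; P₀]) {s : ℕ → ℝ} (hs : Tendsto (fun n => σ2 (s n)) atTop atTop)
    {J K : Finset ℝ} {y z : ℝ → ℝ} (hy : ∀ j ∈ J, 0 < y j) (hz : ∀ k ∈ K, 0 < z k) :
    Tendsto (fun n => ∫⁻ ω, min (scaledMax J id y fun t => W₀ t ω - σ2 t / 2)
      (scaledMax K id z fun t => W₀ (t + s n) ω - σ2 (t + s n) / 2) ∂P₀) atTop (𝓝 0) := by
  let C : ℝ → ℝ → ℝ≥0∞ := fun j k => max (ENNReal.ofReal (y j))⁻¹ (ENNReal.ofReal (z k))⁻¹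
  have hbound : ∀ n, ∫⁻ ω, min (scaledMax J id y fun t => W₀ t ω - σ2 t / 2)
      (scaledMax K id z fun t => W₀ (t + s n) ω - σ2 (t + s n) / 2) ∂P₀
      ≤ ∑ j ∈ J, ∑ k ∈ K,
        C j k * ENNReal.ofReal (Real.exp (-(σ2 (k + s n - j) / 8))) := by
    intro n
    refine (lintegral_mono fun ω => min_scaledMax_le (t := id) (t' := (· + s n))
      fun t => W₀ t ω - σ2 t / 2).trans ?_
    have hm : ∀ a, Measurable fun ω => ENNReal.ofReal (Real.exp (W₀ a ω - σ2 a / 2)) := fun a =>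
      ((hW₀.measurable a).sub measurable_const).exp.ennreal_ofReal
    rw [lintegral_finsetSum _ fun j _ => Finset.measurable_sum _ fun k _ =>
      ((hm _).min (hm _)).const_mul _]
    refine Finset.sum_le_sum fun j _ => ?_
    rw [lintegral_finsetSum _ fun k _ => ((hm _).min (hm _)).const_mul _]
    refine Finset.sum_le_sum fun k _ => ?_
    rw [lintegral_const_mul _ ((hm _).min (hm _))]
    exact mul_right_mono (hW₀.lintegral_min_le hσ2 j (k + s n))
  have hlim : Tendsto (fun n => ∑ j ∈ J, ∑ k ∈ K,
      C j k * ENNReal.ofReal (Real.exp (-(σ2 (k + s n - j) / 8)))) atTop (𝓝 0) := by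
    rw [← Finset.sum_const_zero (s := J)]
    refine tendsto_finsetSum _ fun j hj => ?_
    rw [← Finset.sum_const_zero (s := K)]
    refine tendsto_finsetSum _ fun k hk => ?_
    have hCfin : C j k ≠ ∞ := by
      refine (max_lt ?_ ?_).ne
      · exact ENNReal.inv_lt_top.2 (ENNReal.ofReal_pos.2 (hy j hj))
      · exact ENNReal.inv_lt_top.2 (ENNReal.ofReal_pos.2 (hz k hk))
    rw [← mul_zero (C j k)]
    refine ENNReal.Tendsto.const_mul ?_ (Or.inr hCfin)
    rw [← ENNReal.ofReal_zero]
    refine ENNReal.tendsto_ofReal (Real.tendsto_exp_neg_atTop_nhds_zero.comp ?_)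
    refine Tendsto.atTop_div_const (by norm_num) ?_
    -- The quasi-triangle inequality carries divergence from σ²(s n) to σ²(k + s n - j).
    refine tendsto_atTop_mono (fun n => ?_)
      ((tendsto_atTop_add_const_right _ (-(2 * σ2 (j - k))) hs).atTop_div_const two_pos)
    have h1 := hW₀.variance_add_le (j - k) (k + s n - j)
    rw [← hσ2, ← hσ2, ← hσ2, show k + s n - j + (j - k) = s n by ring] at h1
    linarith
  exact tendsto_of_tendsto_of_tendsto_of_le_of_le tendsto_const_nhds hlim (fun _ => bot_le) hbound

namespace IsBrownResnickInput

/-- Asymptotic independence of the Brown--Resnick process along translations for which the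
variance tends to infinity. -/
theorem tendsto_pathLaw_inter_shift (h : IsBrownResnickInput U W P W₀ P₀)
    (hW₀ : IsGaussianStatIncr W₀ P₀) (hσ2 : ∀ t, σ2 t = Var[W₀ t; P₀])
    {s : ℕ → ℝ} (hs : Tendsto (fun n => σ2 (s n)) atTop atTop)
    {A B : Set (ℝ → ℝ)} (hA : A ∈ orthants) (hB : B ∈ orthants) :
    Tendsto (fun n => pathLaw (brProcess σ2 U W) P (A ∩ shift (s n) ⁻¹' B)) atTop
      (𝓝 (pathLaw (brProcess σ2 U W) P A * pathLaw (brProcess σ2 U W) P B)) := by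
  obtain ⟨J, y, rfl⟩ := hA
  obtain ⟨K, z, rfl⟩ := hB
  rcases eq_or_ne (pathLaw (brProcess σ2 U W) P (orthant J y)) 0 with hA0 | hA0
  · simp [hA0, measure_mono_null Set.inter_subset_left hA0]
  rcases eq_or_ne (pathLaw (brProcess σ2 U W) P (orthant K z)) 0 with hB0 | hB0
  · have h1 : ∀ n, pathLaw (brProcess σ2 U W) P (shift (s n) ⁻¹' orthant K z) = 0 := fun n => by
      rw [(h.measurePreserving_shift hW₀ hσ2 (s n)).measure_preimage
        (measurableSet_orthant K z).nullMeasurableSet, hB0]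
    have h2 : ∀ n, pathLaw (brProcess σ2 U W) P (orthant J y ∩ shift (s n) ⁻¹' orthant K z) = 0 :=
      fun n => measure_mono_null Set.inter_subset_right (h1 n)
    simp [hB0, h2]
  obtain ⟨hy, hJ⟩ := h.pos_of_pathLaw_orthant_ne_zero hW₀ hσ2 hA0
  obtain ⟨hz, hK⟩ := h.pos_of_pathLaw_orthant_ne_zero hW₀ hσ2 hB0
  simp_rw [h.pathLaw_inter_shift hW₀ hσ2, h.pathLaw_orthant hW₀ hσ2]
  rw [← expNeg_add]
  refine (continuous_expNeg.tendsto _).comp ?_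
  have hmin := hW₀.tendsto_lintegral_min_scaledMax hσ2 hs hy hz
  have hmJ : Measurable fun ω => scaledMax J id y fun t => W₀ t ω - σ2 t / 2 :=
    measurable_scaledMax.comp (measurable_pi_lambda _ fun t =>
      (hW₀.measurable t).sub measurable_const)
  have hmK : ∀ r, Measurable fun ω => scaledMax K id z fun t => W₀ (t + r) ω - σ2 (t + r) / 2 :=
    fun r => measurable_scaledMax.comp (measurable_pi_lambda _ fun t =>
      (hW₀.measurable (t + r)).sub measurable_const)
  -- max = sum - min, with finite expectations because the orthants are not null; as the minimum
  -- vanishes in the limit, the exponents add.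
  have hmax : ∀ n, ∫⁻ ω, max (scaledMax J id y fun t => W₀ t ω - σ2 t / 2)
      (scaledMax K id z fun t => W₀ (t + s n) ω - σ2 (t + s n) / 2) ∂P₀
      = (∫⁻ ω, scaledMax J id y (fun t => W₀ t ω - σ2 t / 2) ∂P₀
        + ∫⁻ ω, scaledMax K id z (fun t => W₀ t ω - σ2 t / 2) ∂P₀)
        - ∫⁻ ω, min (scaledMax J id y fun t => W₀ t ω - σ2 t / 2)
          (scaledMax K id z fun t => W₀ (t + s n) ω - σ2 (t + s n) / 2) ∂P₀ := by
    intro n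
    refine ENNReal.eq_sub_of_add_eq ?_ ?_
    · exact ((lintegral_mono fun ω => min_le_left _ _).trans_lt hJ.lt_top).ne
    · rw [← lintegral_add_left (hmJ.max (hmK (s n)))]
      simp_rw [max_add_min]
      rw [lintegral_add_left hmJ, hW₀.lintegral_shift_normalised hσ2 (s n) measurable_scaledMax
        scaledMax_add_const]
  simp_rw [hmax]
  simpa using ENNReal.Tendsto.sub tendsto_const_nhds hmin (Or.inl (ENNReal.add_ne_top.2 ⟨hJ, hK⟩))

/-- One sequence of times with σ² → ∞ is enough; no full mixing is needed. -/
theorem isErgodicProcess_of_unbounded (h : IsBrownResnickInput U W P W₀ P₀)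
    (hW₀ : IsGaussianStatIncr W₀ P₀) (hσ2 : ∀ t, σ2 t = Var[W₀ t; P₀])
    (hunb : ∀ R, ∃ t, R < σ2 t) : IsErgodicProcess (brProcess σ2 U W) P where
  measurable := h.measurable_iSup_brTerm
  stationary := h.measurePreserving_shift hW₀ hσ2
  trivial_of_invariant := fun A hA hinv => by
    have := h.isProbabilityMeasure_pathLaw (σ2 := σ2)
    choose s hs using fun n : ℕ => hunb n
    refine measure_eq_zero_or_one_of_tendsto (s := s) (h.measurePreserving_shift hW₀ hσ2)
      (fun A hA B hB => ?_) hA hinv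
    have h1 := h.tendsto_pathLaw_inter_shift hW₀ hσ2
      (tendsto_atTop_mono (fun n => (hs n).le) tendsto_natCast_atTop_atTop) hA hB
    have h2 := (ENNReal.tendsto_toReal (by finiteness)).comp h1
    rwa [ENNReal.toReal_mul] at h2

/-- If σ² ≤ R, then P(X(0) ≤ 1, X(s) ≤ 1) = e^{-2 + E min} ≥ e^{-2+r} for every s, uniformly above
the square of P(X(0) ≤ 1) = e^{-1}. -/
theorem unbounded_of_isErgodicProcess (h : IsBrownResnickInput U W P W₀ P₀)
    (hW₀ : IsGaussianStatIncr W₀ P₀) (hσ2 : ∀ t, σ2 t = Var[W₀ t; P₀])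
    (herg : IsErgodicProcess (brProcess σ2 U W) P) (R : ℝ) : ∃ t, R < σ2 t := by
  by_contra! hR
  have := h.isProbabilityMeasure_pathLaw (σ2 := σ2)
  set μ := pathLaw (brProcess σ2 U W) P with hμ
  set A : Set (ℝ → ℝ) := orthant {0} (fun _ => 1) with hA
  set r := Real.exp (-(R / 2)) / 2 with hr
  have hr0 : 0 < r := by positivity
  have hone : ∀ t, ∫⁻ ω, ENNReal.ofReal (Real.exp (W₀ t ω - σ2 t / 2)) ∂P₀ = 1 := fun t => by
    rw [hσ2]; exact hW₀.lintegral_exp t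
  have hμA : μ.real A = Real.exp (-1) := by
    rw [measureReal_def, hμ, hA, h.pathLaw_orthant hW₀ hσ2]
    simp only [scaledMax, Finset.sup_singleton, id, ENNReal.ofReal_one, div_one]
    rw [hone, ← ENNReal.ofReal_one, expNeg_ofReal zero_le_one,
      ENNReal.toReal_ofReal (Real.exp_pos _).le]
  have hinter : ∀ s, Real.exp (-(2 - r)) ≤ μ.real (shift s ⁻¹' A ∩ A) := by
    intro s
    rw [measureReal_def, Set.inter_comm, hμ, hA, h.pathLaw_inter_shift hW₀ hσ2,
      ← ENNReal.ofReal_le_iff_le_toReal (lt_of_le_of_lt (expNeg_le_one _) ENNReal.one_lt_top).ne]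
    simp only [scaledMax, Finset.sup_singleton, id, ENNReal.ofReal_one, div_one, zero_add]
    have hm : ∀ a, Measurable fun ω => ENNReal.ofReal (Real.exp (W₀ a ω - σ2 a / 2)) := fun a =>
      ((hW₀.measurable a).sub measurable_const).exp.ennreal_ofReal
    have hsum : ∫⁻ ω, max (ENNReal.ofReal (Real.exp (W₀ 0 ω - σ2 0 / 2)))
        (ENNReal.ofReal (Real.exp (W₀ s ω - σ2 s / 2))) ∂P₀
        + ∫⁻ ω, min (ENNReal.ofReal (Real.exp (W₀ 0 ω - σ2 0 / 2)))
        (ENNReal.ofReal (Real.exp (W₀ s ω - σ2 s / 2))) ∂P₀ = 2 := by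
      rw [← lintegral_add_left ((hm _).max (hm _))]
      simp_rw [max_add_min]
      rw [lintegral_add_left (hm _), hone, hone, one_add_one_eq_two]
    have hmin := hW₀.le_lintegral_min hσ2 hR 0 s
    rw [← hr] at hmin
    have hle : ∫⁻ ω, max (ENNReal.ofReal (Real.exp (W₀ 0 ω - σ2 0 / 2)))
        (ENNReal.ofReal (Real.exp (W₀ s ω - σ2 s / 2))) ∂P₀ ≤ ENNReal.ofReal (2 - r) := by
      rw [ENNReal.ofReal_sub _ hr0.le, ENNReal.ofReal_ofNat]
      refine ENNReal.le_sub_of_add_le_right ENNReal.ofReal_ne_top ?_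
      rw [← hsum]
      gcongr
    have hr2 : 0 ≤ 2 - r := by
      have h1 := hR 0
      rw [hσ2, hW₀.variance_zero] at h1
      have : Real.exp (-(R / 2)) ≤ 1 := Real.exp_le_one_iff.2 (by linarith)
      rw [hr]
      linarith
    rw [← expNeg_ofReal hr2]
    exact antitone_expNeg hle
  -- This δ contradicts e^{-2+r} ≥ e^{-2}(1 + r).
  obtain ⟨s, hs⟩ := exists_measure_inter_preimage_lt (herg.stationary)
    shift_comp_shift shift_zero herg.trivial_of_invariant
    (measurableSet_orthant {0} fun _ => 1) (δ := Real.exp (-2) * r) (by positivity)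
  have h1 := (hinter s).trans_lt hs
  rw [← hA, ← hμ, hμA, ← Real.exp_nat_mul, show -(2 - r) = -2 + r by ring, Real.exp_add] at h1
  norm_num at h1
  have h2 := Real.add_one_le_exp r
  have h3 := Real.exp_pos (-2)
  nlinarith

end IsBrownResnickInput

end ErgodicityCriterion

end

end BrownResnick

theorem proposition1 {Ω Ω₀ : Type*} [MeasurableSpace Ω] [MeasurableSpace Ω₀]
    (P : Measure Ω) [IsProbabilityMeasure P] (P₀ : Measure Ω₀) [IsProbabilityMeasure P₀]
    (W₀ : ℝ → Ω₀ → ℝ) (hW₀ : BrownResnick.IsGaussianStatIncr W₀ P₀)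
    (σ2 : ℝ → ℝ) (hσ2 : ∀ t, σ2 t = variance (W₀ t) P₀)
    (U : ℕ → Ω → ℝ) (W : ℕ → ℝ → Ω → ℝ)
    (hUW : BrownResnick.IsBrownResnickInput U W P W₀ P₀) :
    (∀ t, ∀ᵐ ω ∂P, IsGreatest (Set.range (BrownResnick.brTerm σ2 U W t ω))
      (BrownResnick.brProcess σ2 U W t ω)) ∧
    List.TFAE [
      BrownResnick.IsErgodicProcess (BrownResnick.brProcess σ2 U W) P,
      ∃ D : Set ℝ, D ⊆ Set.Ici 0 ∧ MeasurableSet D ∧ BrownResnick.upperDensity D = 0 ∧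
        BrownResnick.TendsToInftyOutside σ2 D,
      ∀ ε : ℝ, 0 < ε → ∃ D : Set ℝ, D ⊆ Set.Ici 0 ∧ MeasurableSet D ∧
        BrownResnick.upperDensity D ≤ ENNReal.ofReal ε ∧
        BrownResnick.TendsToInftyOutside σ2 D] := by
  refine ⟨hUW.ae_isGreatest hW₀ hσ2, ?_⟩
  have hσ : σ2 = fun t => variance (W₀ t) P₀ := funext hσ2
  tfae_have 1 → 2 := by
    intro herg
    refine BrownResnick.exists_density_zero_tendsto ?_ (fun t => ?_) (fun s t => ?_)
      (hUW.unbounded_of_isErgodicProcess hW₀ hσ2 herg)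
    · rw [hσ]; exact hW₀.continuous_variance
    · simp_rw [hσ]; exact hW₀.variance_neg t
    · simp_rw [hσ]; exact hW₀.variance_add_le s t
  tfae_have 2 → 3 := by
    rintro ⟨D, hD, hDm, hD0, hDσ⟩ ε -
    exact ⟨D, hD, hDm, hD0.trans_le bot_le, hDσ⟩
  tfae_have 3 → 1 := by
    intro h
    obtain ⟨D, -, -, hD, hDσ⟩ := h (1 / 4) (by norm_num)
    exact hUW.isErgodicProcess_of_unbounded hW₀ hσ2
      (BrownResnick.unbounded_of_tendsToInftyOutside hD hDσ)
  tfae_finish
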